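/- Let $U=\{(r,\theta_1,\theta_2,\phi_1,\phi_2,\psi)\in\mathbb R^6: r>0,\ 0<\theta_1,\theta_2<\pi\}$ be the standard coordinate patch (angles $\phi_i,\psi$ taken as real variables) of the conifold $C(T^{1,1})$, with cone metric $$\bar g=dr^2+r^2\Big(\tfrac16\sum_{i=1}^2(d\theta_i^2+\sin^2\theta_i\,d\phi_i^2)+\tfrac19(d\psi+\cos\theta_1d\phi_1+\cos\theta_2d\phi_2)^2\Big),$$ contact form $\eta=\tfrac13(d\psi+\cos\theta_1d\phi_1+\cos\theta_2d\phi_2)$, Kähler form $\omega=\tfrac12d(r^2\eta)$, and complex structure $J$ given by $J\partial_r=\tfrac3r\partial_\psi$, $J\partial_\psi=-\tfrac r3\partial_r$, $J\partial_{\theta_i}=-\tfrac1{\sin\theta_i}\partial_{\phi_i}+\cot\theta_i\,\partial_\psi$, $J\partial_{\phi_i}=\sin\theta_i\,\partial_{\theta_i}-\tfrac r3\cos\theta_i\,\partial_r$. Put $e_1=\partial_{\phi_1}+\partial_\psi$, $e_2=\partial_{\phi_2}-\partial_{\phi_1}$, $e_3=-\partial_{\phi_1}-\partial_{\phi_2}$;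 $\Phi^1=\psi$, $\Phi^2=\tfrac12(\psi-\phi_1+\phi_2)$, $\Phi^3=\tfrac12(\psi-\phi_1-\phi_2)$; and let $y^i=\tfrac12r^2\eta(e_i)$ be the momentum map. Let $v_1=(1,1,1)$, $v_2=(1,0,1)$, $v_3=(1,0,0)$, $v_4=(1,1,0)$, $B=(3,\tfrac32,\tfrac32)$, $B^{can}=\sum_Av_A$, let $\mathcal C^\circ=\{y\in\mathbb R^3:\langle v_A,y\rangle>0\ \forall A\}$, and on $\mathcal C^\circ$ let $G=G^{can}+G^B$ with $$G^{can}=\tfrac12\sum_{A=1}^4\langle v_A,y\rangle\log\langle v_A,y\rangle,\qquad G^B=\tfrac12\langle B,y\rangle\log\langle B,y\rangle-\tfrac12\langle B^{can},y\rangle\log\langle B^{can},y\rangle .$$ Write $G_{ij}=\partial^2G/\partial y^i\partial y^j$ and $(G^{ij})=(G_{ij})^{-1}$. Then: 1. On $U$: $J^2=-1$, $J(r\partial_r)=3\partial_\psi$ (the Reeb field), $\omega(X,Y)=\bar g(JX,Y)$ and $\eta(3\partial_\psi)=1$. Moreover $d\Phi^i(e_j)=\delta^i_j$, $3\partial_\psi=\sum_iB^ie_i$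 and $B^{can}=(4,2,2)$. 2. $y=\big(\tfrac16r^2(\cos\theta_1+1),\ \tfrac16r^2(\cos\theta_2-\cos\theta_1),\ -\tfrac16r^2(\cos\theta_1+\cos\theta_2)\big)$. This map sends $U$ onto $\mathcal C^\circ$, and sends the region $r>0$, $0\le\theta_i\le\pi$ onto $\{y\ne0:\langle v_A,y\rangle\ge0\ \forall A\}$. 3. $G$ is a symplectic potential of the cone: it is smooth and strictly convex on $\mathcal C^\circ$ with positive definite Hessian, $B_i=2\sum_jG_{ij}y^j$ there, and on $U$ $$\omega=\sum_idy^i\wedge d\Phi^i,\qquad \bar g=\sum_{i,j}\big(G_{ij}\,dy^idy^j+G^{ij}\,d\Phi^id\Phi^j\big).$$ It solves the Monge–Ampère equation $\det(G_{ij})=\frac{81e^3}{2^{11}}\exp\big(-2\,\partial G/\partial y^1\big)$ on $\mathcal C^\circ$. 4. The Legendre map $y\mapsto x$, $x^i=\partial G/\partial y^i$, is a bijection $\mathcal C^\circ\to\mathbb R^3$. There is a smooth $F$ on $\mathbb R^3$ (the Kähler potential) with $F(x)=\sum_iy^ix^i-G(y)$ and $\partial F/\partial x^i=y^i$ whenever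 $x$ corresponds to $y\in\mathcal C^\circ$; at points of $U$ it equals $r^2/4$. 5. On $U$ one has $z^i=x^i-k_i+\mathrm i\,\Phi^i$, with $k_1=\tfrac32-\tfrac{11}2\log2$, $k_2=k_3=\tfrac34-\tfrac74\log2$, where $$\begin{aligned}z^1&=3\log r+\log\sin\theta_1+\log\sin\theta_2+\mathrm i\psi,\\ z^2&=\tfrac32\log r+\log\sin\tfrac{\theta_1}2+\log\cos\tfrac{\theta_2}2+\tfrac{\mathrm i}2(\psi-\phi_1+\phi_2),\\ z^3&=\tfrac32\log r+\log\sin\tfrac{\theta_1}2+\log\sin\tfrac{\theta_2}2+\tfrac{\mathrm i}2(\psi-\phi_1-\phi_2).\end{aligned}$$ These are holomorphic coordinates: $z$ is smooth, maps $U$ bijectively onto $\mathbb C^3$, has invertible differential at every point of $U$, and $dz^i\circ J=\mathrm i\,dz^i$. 6. In these coordinates the holomorphic volume form is $\Omega=e^{z^1}dz^1\wedge dz^2\wedge dz^3$, up to a multiplicative constant. That is, a complex $3$-form $W$ on $U$ is smooth, closed, of type $(3,0)$ for $J$, and normalized by $\frac{\mathrm i^3}{2^3}(-1)^3\,W\wedge\overline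 W=\frac1{3!}\omega^3$, if and only if $W=c\,e^{z^1}dz^1\wedge dz^2\wedge dz^3$ on $U$ for a constant $c\in\mathbb C$ with $|c|=\tfrac19$. -/

import Mathlib

open scoped ContDiff

noncomputable section

namespace Conifold

/-! ### The coordinate patch of the conifold and its Calabi-Yau cone geometry -/

/-- Local coordinates `(r, θ₁, θ₂, φ₁, φ₂, ψ)` on the cone over `T^{1,1}`, in this order. -/
abbrev Coord := Fin 6 → ℝ

/-- The coordinate patch `r > 0`, `0 < θ₁ < π`, `0 < θ₂ < π`; the angles `φ₁, φ₂, ψ` are real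
variables. -/
def patch : Set Coord :=
  {p | 0 < p 0 ∧ (0 < p 1 ∧ p 1 < Real.pi) ∧ (0 < p 2 ∧ p 2 < Real.pi)}

/-- The same region with the poles `θᵢ = 0, π` added. -/
def closedPatch : Set Coord :=
  {p | 0 < p 0 ∧ (0 ≤ p 1 ∧ p 1 ≤ Real.pi) ∧ (0 ≤ p 2 ∧ p 2 ≤ Real.pi)}

/-- The metric of `T^{1,1}`,
`(1/6) ∑ᵢ (dθᵢ² + sin² θᵢ dφᵢ²) + (1/9) (dψ + cos θ₁ dφ₁ + cos θ₂ dφ₂)²`. -/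
def metricT11 (p v w : Coord) : ℝ :=
  (1 / 6) * (v 1 * w 1 + Real.sin (p 1) ^ 2 * (v 3 * w 3)
      + v 2 * w 2 + Real.sin (p 2) ^ 2 * (v 4 * w 4))
    + (1 / 9) * ((v 5 + Real.cos (p 1) * v 3 + Real.cos (p 2) * v 4)
      * (w 5 + Real.cos (p 1) * w 3 + Real.cos (p 2) * w 4))

/-- The cone metric `dr² + r² g`. -/
def coneMetric (p v w : Coord) : ℝ := v 0 * w 0 + p 0 ^ 2 * metricT11 p v w

/-- The contact form `η = (1/3) (dψ + cos θ₁ dφ₁ + cos θ₂ dφ₂)`. -/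
def eta (p : Coord) : Coord →L[ℝ] ℝ :=
  (1 / 3 : ℝ) • (ContinuousLinearMap.proj (R := ℝ) (φ := fun _ : Fin 6 => ℝ) 5
    + Real.cos (p 1) • ContinuousLinearMap.proj (R := ℝ) (φ := fun _ : Fin 6 => ℝ) 3
    + Real.cos (p 2) • ContinuousLinearMap.proj (R := ℝ) (φ := fun _ : Fin 6 => ℝ) 4)

/-- The Kähler form of the cone, `ω = (1/2) d (r² η)`. -/
def kahlerForm : Coord → Coord [⋀^Fin 2]→L[ℝ] ℝ :=
  extDeriv fun p => (p 0 ^ 2 / 2) •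
    ContinuousAlternatingMap.ofSubsingleton ℝ Coord ℝ (0 : Fin 1) (eta p)

/-- The complex structure of the cone, in the coordinate frame:
`J ∂_r = (3/r) ∂_ψ`, `J ∂_{θᵢ} = - (1/sin θᵢ) ∂_{φᵢ} + cot θᵢ ∂_ψ`,
`J ∂_{φᵢ} = sin θᵢ ∂_{θᵢ} - (r/3) cos θᵢ ∂_r`, `J ∂_ψ = - (r/3) ∂_r`. -/
def coneJ (p v : Coord) : Coord :=
  ![-(p 0 / 3) * (v 5 + Real.cos (p 1) * v 3 + Real.cos (p 2) * v 4),
    Real.sin (p 1) * v 3,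
    Real.sin (p 2) * v 4,
    -(v 1 / Real.sin (p 1)),
    -(v 2 / Real.sin (p 2)),
    3 / p 0 * v 0 + Real.cos (p 1) / Real.sin (p 1) * v 1
      + Real.cos (p 2) / Real.sin (p 2) * v 2]

/-- The Euler (dilatation) vector field `r ∂_r`. -/
def eulerField (p : Coord) : Coord := ![p 0, 0, 0, 0, 0, 0]

/-- The Reeb vector field `3 ∂_ψ`. -/
def reebField : Coord := ![0, 0, 0, 0, 0, 3]

/-! ### Angle coordinates and the momentum map -/

/-- The angles `Φ¹ = ψ`, `Φ² = (-φ₁ + φ₂ + ψ)/2`, `Φ³ = (-φ₁ - φ₂ + ψ)/2`. -/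
def angle (p : Coord) : Fin 3 → ℝ :=
  ![p 5, (-p 3 + p 4 + p 5) / 2, (-p 3 - p 4 + p 5) / 2]

/-- The generators of the torus action dual to the angles:
`e₁ = ∂_{φ₁} + ∂_ψ`, `e₂ = ∂_{φ₂} - ∂_{φ₁}`, `e₃ = - ∂_{φ₁} - ∂_{φ₂}`. -/
def torusField : Fin 3 → Coord :=
  ![![0, 0, 0, 1, 0, 1], ![0, 0, 0, -1, 1, 0], ![0, 0, 0, -1, -1, 0]]

/-- The momentum map `yⁱ = (1/2) r² η(eᵢ)`. -/
def momentum (p : Coord) : Fin 3 → ℝ := fun i => 1 / 2 * p 0 ^ 2 * eta p (torusField i)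

/-! ### Toric data and the symplectic potential -/

/-- The inward normals of the momentum cone. -/
def normal : Fin 4 → Fin 3 → ℝ := ![![1, 1, 1], ![1, 0, 1], ![1, 0, 0], ![1, 1, 0]]

/-- The Reeb vector in the basis of torus generators. -/
def reebVec : Fin 3 → ℝ := ![3, 3 / 2, 3 / 2]

/-- `B^can = ∑_A v_A`. -/
def canVec : Fin 3 → ℝ := ∑ A, normal A

/-- The interior of the momentum cone. -/
def openCone : Set (Fin 3 → ℝ) := {y | ∀ A, 0 < normal A ⬝ᵥ y}

/-- `G^can = (1/2) ∑_A ⟨v_A, y⟩ log ⟨v_A, y⟩`. -/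
def Gcan (y : Fin 3 → ℝ) : ℝ :=
  ∑ A, 1 / 2 * (normal A ⬝ᵥ y) * Real.log (normal A ⬝ᵥ y)

/-- `G^B = (1/2) ⟨B, y⟩ log ⟨B, y⟩ - (1/2) ⟨B^can, y⟩ log ⟨B^can, y⟩`. -/
def GB (y : Fin 3 → ℝ) : ℝ :=
  1 / 2 * (reebVec ⬝ᵥ y) * Real.log (reebVec ⬝ᵥ y)
    - 1 / 2 * (canVec ⬝ᵥ y) * Real.log (canVec ⬝ᵥ y)

/-- The symplectic potential. -/
def G (y : Fin 3 → ℝ) : ℝ := Gcan y + GB y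

/-- The partial derivative `∂f/∂yⁱ` of a function on `ℝ³`. -/
def pd (i : Fin 3) (f : (Fin 3 → ℝ) → ℝ) (y : Fin 3 → ℝ) : ℝ := fderiv ℝ f y (Pi.single i 1)

/-- The Legendre map `y ↦ x`, `xⁱ = ∂G/∂yⁱ`. -/
def gradG (y : Fin 3 → ℝ) : Fin 3 → ℝ := fun i => pd i G y

/-- The Hessian matrix `G_{ij}`. -/
def hessG (y : Fin 3 → ℝ) : Matrix (Fin 3) (Fin 3) ℝ := Matrix.of fun i j => pd i (pd j G) y

/-! ### Complex coordinates and the holomorphic volume form -/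

/-- The complex coordinates `z¹, z², z³`. -/
def zc (p : Coord) : Fin 3 → ℂ :=
  ![((3 * Real.log (p 0) + Real.log (Real.sin (p 1)) + Real.log (Real.sin (p 2)) : ℝ) : ℂ)
      + Complex.I * (p 5 : ℝ),
    ((3 / 2 * Real.log (p 0) + Real.log (Real.sin (p 1 / 2))
        + Real.log (Real.cos (p 2 / 2)) : ℝ) : ℂ)
      + Complex.I / 2 * ((p 5 - p 3 + p 4 : ℝ) : ℂ),
    ((3 / 2 * Real.log (p 0) + Real.log (Real.sin (p 1 / 2))
        + Real.log (Real.sin (p 2 / 2)) : ℝ) : ℂ)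
      + Complex.I / 2 * ((p 5 - p 3 - p 4 : ℝ) : ℂ)]

/-- The additive constants by which `∂G/∂yⁱ` differs from the real part of `zⁱ`. -/
def shift : Fin 3 → ℝ :=
  ![3 / 2 - 11 / 2 * Real.log 2, 3 / 4 - 7 / 4 * Real.log 2, 3 / 4 - 7 / 4 * Real.log 2]

/-- The wedge product `α₁ ∧ α₂ ∧ α₃` of three complex-valued covectors,
`(v₁, v₂, v₃) ↦ ∑_σ sign σ ∏ᵢ αᵢ (v_{σ i})`. -/
def wedge3 (α : Fin 3 → (Coord →L[ℝ] ℂ)) : Coord [⋀^Fin 3]→L[ℝ] ℂ :=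
  ContinuousMultilinearMap.alternatization
    ((ContinuousMultilinearMap.mkPiAlgebra ℝ (Fin 3) ℂ).compContinuousLinearMap α)

/-- The complex three-form `e^{z¹} dz¹ ∧ dz² ∧ dz³`. -/
def Omega (p : Coord) : Coord [⋀^Fin 3]→L[ℝ] ℂ :=
  Complex.exp (zc p 0) • wedge3 fun i => fderiv ℝ (fun q => zc q i) p

/-- The wedge product of alternating forms (the sum over shuffles). -/
def wedge {A : Type} [CommRing A] [Algebra ℝ A] {m n : ℕ}
    (α : Coord [⋀^Fin m]→ₗ[ℝ] A) (β : Coord [⋀^Fin n]→ₗ[ℝ] A) :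
    Coord [⋀^Fin (m + n)]→ₗ[ℝ] A :=
  ((LinearMap.mul' ℝ A).compAlternatingMap (α.domCoprod β)).domDomCongr finSumFinEquiv

/-- The volume form `ω³ / 3!` of the cone. -/
def coneVol (p : Coord) (v : Fin 6 → Coord) : ℝ :=
  1 / (Nat.factorial 3 : ℝ) *
    wedge (wedge (kahlerForm p).toAlternatingMap (kahlerForm p).toAlternatingMap)
      (kahlerForm p).toAlternatingMap v

/-- The complex conjugate of a complex-valued form. -/
def conjForm (α : Coord [⋀^Fin 3]→L[ℝ] ℂ) : Coord [⋀^Fin 3]→L[ℝ] ℂ :=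
  (Complex.conjCLE : ℂ →L[ℝ] ℂ).compContinuousAlternatingMap α

/-- `W` is a holomorphic volume form on the patch: a smooth closed form of type `(3,0)` for the
complex structure of the cone, normalized by
`(i/2)³ (-1)³ W ∧ W̄ = ω³ / 3!` (so `m(m+1)/2 = 3` with `m = 2`). -/
structure IsHolVolForm (W : Coord → Coord [⋀^Fin 3]→L[ℝ] ℂ) : Prop where
  smooth : ContDiffOn ℝ ∞ W patch
  type_three_zero : ∀ p ∈ patch, ∀ (v : Fin 3 → Coord) (j : Fin 3),
    W p (Function.update v j (coneJ p (v j))) = Complex.I * W p v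
  closed : ∀ p ∈ patch, extDeriv W p = 0
  normalized : ∀ p ∈ patch, ∀ v : Fin 6 → Coord,
    Complex.I ^ 3 / 2 ^ 3 * (-1) ^ 3 *
      wedge (W p).toAlternatingMap (conjForm (W p)).toAlternatingMap v = (coneVol p v : ℂ)

end Conifold

end

/-! Everything becomes explicit in half-angles. Along the momentum map each facet form ⟨v_A, y⟩ is
r²/3 times a squared sine or cosine of θᵢ/2, while ⟨B, y⟩ and ⟨B^can, y⟩ are multiples of r²
(`momentum_linear_forms`). The gradient of G is a combination of logarithms of these forms, hence
equals Re z up to constants (`gradG_momentum`). This identity ties the toric side to the complex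
side.

Differentiating it gives d(Re z) = H dy with H the Hessian of G. As J exchanges d(Re z) and dΦ up to
sign, z is holomorphic and dy∘J = -H⁻¹dΦ; the Darboux form of ω and g(v, w) = -ω(Jv, w) then give
the metric. The half-angle tangents recover (r, θ₁, θ₂) from Re z, so z and the Legendre map are
bijective; r³ is an explicit function of Re z, and r²/4 is the Kähler potential.

For Ω, the change of frame from (dy, dΦ) to (dz, dz̄) has determinant 8i det H, and by Monge–Ampère
|e^{z¹}|² det H = 81, which forces |c| = 1/9. Conversely a (3,0)-form is fΩ; closedness makes f
holomorphic, the normalization fixes |f|, and so f is constant on the connected patch. -/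

noncomputable section

namespace Conifold

/-! ### The coordinate patch and its Kähler cone structure -/

lemma eta_apply (p v : Coord) :
    eta p v = 1 / 3 * (v 5 + Real.cos (p 1) * v 3 + Real.cos (p 2) * v 4) := by
  simp [eta]
  ring

lemma patch_isOpen : IsOpen patch := by
  have h : patch = {p : Coord | 0 < p 0} ∩ (({p | 0 < p 1} ∩ {p | p 1 < Real.pi}) ∩
      ({p | 0 < p 2} ∩ {p | p 2 < Real.pi})) := rfl
  rw [h]
  exact (isOpen_lt (by fun_prop) (by fun_prop)).inter
    (((isOpen_lt (by fun_prop) (by fun_prop)).inter (isOpen_lt (by fun_prop) (by fun_prop))).inter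
    ((isOpen_lt (by fun_prop) (by fun_prop)).inter (isOpen_lt (by fun_prop) (by fun_prop))))

lemma patch_convex : Convex ℝ patch := by
  have hl (k : Fin 6) (a : ℝ) : Convex ℝ {p : Coord | a < p k} :=
    convex_halfSpace_gt (LinearMap.proj k : Coord →ₗ[ℝ] ℝ).isLinear a
  have hu (k : Fin 6) (a : ℝ) : Convex ℝ {p : Coord | p k < a} :=
    convex_halfSpace_lt (LinearMap.proj k : Coord →ₗ[ℝ] ℝ).isLinear a
  exact (hl 0 0).inter (((hl 1 0).inter (hu 1 _)).inter ((hl 2 0).inter (hu 2 _)))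

section patch

variable {p : Coord} (hp : p ∈ patch)
include hp

lemma patch_sin_one : 0 < Real.sin (p 1) := Real.sin_pos_of_pos_of_lt_pi hp.2.1.1 hp.2.1.2

lemma patch_sin_two : 0 < Real.sin (p 2) := Real.sin_pos_of_pos_of_lt_pi hp.2.2.1 hp.2.2.2

lemma patch_cos_one : -1 < Real.cos (p 1) ∧ Real.cos (p 1) < 1 := by
  constructor <;> nlinarith [patch_sin_one hp, Real.sin_sq_add_cos_sq (p 1), Real.cos_le_one (p 1),
    Real.neg_one_le_cos (p 1)]

lemma patch_cos_two : -1 < Real.cos (p 2) ∧ Real.cos (p 2) < 1 := by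
  constructor <;> nlinarith [patch_sin_two hp, Real.sin_sq_add_cos_sq (p 2), Real.cos_le_one (p 2),
    Real.neg_one_le_cos (p 2)]

lemma coneJ_coneJ (v : Coord) : coneJ p (coneJ p v) = -v := by
  have h0 := hp.1.ne'
  have h1 := (patch_sin_one hp).ne'
  have h2 := (patch_sin_two hp).ne'
  ext i
  fin_cases i <;> simp [coneJ] <;> field_simp <;> ring

lemma coneJ_eulerField : coneJ p (eulerField p) = reebField := by
  have h0 := hp.1.ne'
  ext i
  fin_cases i <;> simp [coneJ, eulerField, reebField]
  field_simp

end patch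

lemma eta_reebField (p : Coord) : eta p reebField = 1 := by
  simp [eta_apply, reebField]

lemma hasFDerivAt_cos_apply (k : Fin 6) (p : Coord) :
    HasFDerivAt (fun q : Coord => Real.cos (q k))
      (-Real.sin (p k) • ContinuousLinearMap.proj (R := ℝ) (φ := fun _ : Fin 6 => ℝ) k) p :=
  (hasFDerivAt_apply (𝕜 := ℝ) k p).cos

lemma hasFDerivAt_sq_apply (k : Fin 6) (p : Coord) :
    HasFDerivAt (fun q : Coord => q k ^ 2)
      ((2 * p k) • ContinuousLinearMap.proj (R := ℝ) (φ := fun _ : Fin 6 => ℝ) k) p := by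
  simpa using (hasFDerivAt_apply (𝕜 := ℝ) k p).pow 2

/-- The derivative of the coefficients of `r² η / 2`. -/
lemma fderiv_sq_mul_eta (p v w : Coord) :
    fderiv ℝ (fun q : Coord => q 0 ^ 2 / 2 * eta q w) p v
      = p 0 * v 0 * eta p w
        - p 0 ^ 2 / 6 * (Real.sin (p 1) * v 1 * w 3 + Real.sin (p 2) * v 2 * w 4) := by
  have h := ((hasFDerivAt_sq_apply 0 p).mul_const (1 / 2 : ℝ)).mul
    (((((hasFDerivAt_cos_apply 1 p).mul_const (w 3)).const_add (w 5)).add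
      ((hasFDerivAt_cos_apply 2 p).mul_const (w 4))).const_mul (1 / 3 : ℝ))
  have e : (fun q : Coord => q 0 ^ 2 / 2 * eta q w) = fun q : Coord => q 0 ^ 2 * (1 / 2) *
      (1 / 3 * (w 5 + Real.cos (q 1) * w 3 + Real.cos (q 2) * w 4)) := by
    ext q; rw [eta_apply]; ring
  rw [e]
  erw [h.fderiv]
  simp [eta_apply]
  ring

lemma differentiable_eta : Differentiable ℝ eta := by
  unfold eta
  fun_prop

lemma kahlerForm_apply (p v w : Coord) :
    kahlerForm p ![v, w] = p 0 * (v 0 * eta p w - w 0 * eta p v)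
      - p 0 ^ 2 / 6 * (Real.sin (p 1) * (v 1 * w 3 - w 1 * v 3)
        + Real.sin (p 2) * (v 2 * w 4 - w 2 * v 4)) := by
  have hd : DifferentiableAt ℝ (fun q : Coord => (q 0 ^ 2 / 2) •
      ContinuousAlternatingMap.ofSubsingleton ℝ Coord ℝ (0 : Fin 1) (eta q)) p := by
    have h1 : DifferentiableAt ℝ (fun q : Coord =>
        ContinuousAlternatingMap.ofSubsingleton ℝ Coord ℝ (0 : Fin 1) (eta q)) p :=
      ((ContinuousAlternatingMap.ofSubsingletonLIE (𝕜 := ℝ) (E := Coord) (F := ℝ)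
        (0 : Fin 1)).toContinuousLinearEquiv.differentiable.comp differentiable_eta) p
    have h2 : DifferentiableAt ℝ (fun q : Coord => q 0 ^ 2 / 2) p := by fun_prop
    exact h2.smul h1
  rw [kahlerForm, extDeriv_apply hd]
  simp only [ContinuousAlternatingMap.smul_apply,
    ContinuousAlternatingMap.ofSubsingleton_apply_apply, smul_eq_mul]
  rw [Fin.sum_univ_two]
  have e0 : Fin.removeNth 0 ![v, w] 0 = w := rfl
  have e1 : Fin.removeNth 1 ![v, w] 0 = v := rfl
  rw [e0, e1]
  simp [fderiv_sq_mul_eta]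
  ring

lemma kahlerForm_eq_coneMetric {p : Coord} (hp : p ∈ patch) (v w : Coord) :
    kahlerForm p ![v, w] = coneMetric p (coneJ p v) w := by
  have h0 := hp.1.ne'
  have h1 := (patch_sin_one hp).ne'
  have h2 := (patch_sin_two hp).ne'
  rw [kahlerForm_apply, eta_apply, eta_apply]
  simp [coneMetric, metricT11, coneJ]
  field_simp
  ring

/-! ### Angles and momentum map -/

lemma fderiv_angle (p v : Coord) (i : Fin 3) :
    fderiv ℝ (fun q => angle q i) p v = angle v i := by
  let A : Coord →ₗ[ℝ] ℝ :=
    { toFun := fun q => angle q i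
      map_add' := fun a b => by fin_cases i <;> simp [angle] <;> ring
      map_smul' := fun a b => by fin_cases i <;> simp [angle] <;> ring }
  exact congrArg (· v) (A.toContinuousLinearMap.fderiv (x := p))

lemma angle_torusField (i j : Fin 3) : angle (torusField j) i = if i = j then 1 else 0 := by
  fin_cases i <;> fin_cases j <;> simp [angle, torusField]

lemma reebField_eq : reebField = ∑ i, reebVec i • torusField i := by
  ext k
  fin_cases k <;> simp [reebField, Fin.sum_univ_three, reebVec, torusField]
  all_goals norm_num

lemma canVec_eq : canVec = ![4, 2, 2] := by
  ext k
  fin_cases k <;> simp [canVec, normal, Fin.sum_univ_four] <;> norm_num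

lemma momentum_eq (p : Coord) : momentum p =
    ![1 / 6 * p 0 ^ 2 * (Real.cos (p 1) + 1),
      1 / 6 * p 0 ^ 2 * (Real.cos (p 2) - Real.cos (p 1)),
      -(1 / 6 * p 0 ^ 2 * (Real.cos (p 1) + Real.cos (p 2)))] := by
  ext k
  fin_cases k <;> simp [momentum, torusField, eta_apply] <;> ring

/-- The differential of the momentum map. -/
def dmomentum (p v : Coord) : Fin 3 → ℝ :=
  ![1 / 3 * p 0 * (Real.cos (p 1) + 1) * v 0 - 1 / 6 * p 0 ^ 2 * Real.sin (p 1) * v 1,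
    1 / 3 * p 0 * (Real.cos (p 2) - Real.cos (p 1)) * v 0
      - 1 / 6 * p 0 ^ 2 * (Real.sin (p 2) * v 2 - Real.sin (p 1) * v 1),
    -(1 / 3 * p 0 * (Real.cos (p 1) + Real.cos (p 2)) * v 0
      - 1 / 6 * p 0 ^ 2 * (Real.sin (p 1) * v 1 + Real.sin (p 2) * v 2))]

lemma differentiable_momentum : Differentiable ℝ momentum := by
  rw [differentiable_pi]
  intro i
  fin_cases i <;> simp only [momentum_eq] <;> simp <;> fun_prop

lemma fderiv_momentum (p v : Coord) (i : Fin 3) :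
    fderiv ℝ (fun q => momentum q i) p v = dmomentum p v i := by
  have hr := (hasFDerivAt_sq_apply 0 p).const_mul (1 / 6 : ℝ)
  have h1 := hasFDerivAt_cos_apply 1 p
  have h2 := hasFDerivAt_cos_apply 2 p
  fin_cases i <;> simp only [momentum_eq] <;> simp [dmomentum]
  · have h := (hr.mul (h1.add_const 1)).fderiv
    simp only [one_div] at h
    erw [h]
    simp
    ring
  · have h := (hr.mul (h2.sub h1)).fderiv
    simp only [one_div] at h
    erw [h]
    simp
    ring
  · have h := (hr.mul (h1.add h2)).fderiv
    simp only [one_div] at h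
    erw [h]
    simp
    ring

/-- Since η kills ∂_r and ∂_{θᵢ}, and the eᵢ are dual to the dΦⁱ, r²η/2 = ∑ yⁱ dΦⁱ; this is its
exterior derivative. -/
lemma kahlerForm_darboux (p v w : Coord) :
    kahlerForm p ![v, w]
      = ∑ i, (dmomentum p v i * angle w i - dmomentum p w i * angle v i) := by
  rw [kahlerForm_apply, eta_apply, eta_apply]
  simp [Fin.sum_univ_three, dmomentum, angle]
  ring

/-! ### The momentum cone -/

lemma normal_dotProduct (y : Fin 3 → ℝ) :
    normal 0 ⬝ᵥ y = y 0 + y 1 + y 2 ∧ normal 1 ⬝ᵥ y = y 0 + y 2 ∧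
      normal 2 ⬝ᵥ y = y 0 ∧ normal 3 ⬝ᵥ y = y 0 + y 1 := by
  refine ⟨?_, ?_, ?_, ?_⟩ <;> simp [normal, dotProduct, Fin.sum_univ_three]

lemma mem_openCone {y : Fin 3 → ℝ} :
    y ∈ openCone ↔ 0 < y 0 + y 1 + y 2 ∧ 0 < y 0 + y 2 ∧ 0 < y 0 ∧ 0 < y 0 + y 1 := by
  obtain ⟨h0, h1, h2, h3⟩ := normal_dotProduct y
  simp only [openCone, Set.mem_ofPred_eq, Fin.forall_fin_succ, Fin.succ_zero_eq_one,
    Fin.succ_one_eq_two, IsEmpty.forall_iff, and_true]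
  rw [show (Fin.succ 2 : Fin 4) = 3 from rfl, h0, h1, h2, h3]

lemma mem_closedCone {y : Fin 3 → ℝ} :
    (∀ A, 0 ≤ normal A ⬝ᵥ y) ↔
      0 ≤ y 0 + y 1 + y 2 ∧ 0 ≤ y 0 + y 2 ∧ 0 ≤ y 0 ∧ 0 ≤ y 0 + y 1 := by
  obtain ⟨h0, h1, h2, h3⟩ := normal_dotProduct y
  simp only [Fin.forall_fin_succ, Fin.succ_zero_eq_one,
    Fin.succ_one_eq_two, IsEmpty.forall_iff, and_true]
  rw [show (Fin.succ 2 : Fin 4) = 3 from rfl, h0, h1, h2, h3]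

lemma reebVec_dotProduct (y : Fin 3 → ℝ) : reebVec ⬝ᵥ y = 3 / 2 * (2 * y 0 + y 1 + y 2) := by
  simp [reebVec, dotProduct, Fin.sum_univ_three]
  ring

lemma canVec_dotProduct (y : Fin 3 → ℝ) : canVec ⬝ᵥ y = 2 * (2 * y 0 + y 1 + y 2) := by
  simp [canVec_eq, dotProduct, Fin.sum_univ_three]
  ring

lemma openCone_isOpen : IsOpen openCone := by
  have : openCone = ⋂ A, {y | 0 < normal A ⬝ᵥ y} := by ext; simp [openCone]
  rw [this]
  refine isOpen_iInter_of_finite fun A => isOpen_lt continuous_const ?_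
  exact continuous_const.dotProduct continuous_id

lemma openCone_convex : Convex ℝ openCone := by
  have : openCone = ⋂ A, {y | 0 < normal A ⬝ᵥ y} := by ext; simp [openCone]
  rw [this]
  exact convex_iInter fun A => convex_halfSpace_gt
    ⟨dotProduct_add (normal A), fun c y => dotProduct_smul c (normal A) y⟩ 0

/-- A point of the patch (with poles) over a point of the momentum cone. -/
def momentumSection (y : Fin 3 → ℝ) : Coord :=
  ![Real.sqrt (3 * (2 * y 0 + y 1 + y 2)), Real.arccos (-(y 1 + y 2) / (2 * y 0 + y 1 + y 2)),
    Real.arccos ((y 1 - y 2) / (2 * y 0 + y 1 + y 2)), 0, 0, 0]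

/-- The section inverts 2y¹ + y² + y³ = r²/3, -(y² + y³) = (r²/3) cos θ₁ and y² - y³ = (r²/3) cos
θ₂. The facet inequalities are exactly what keeps both arccosine arguments in [-1, 1]. -/
lemma momentum_momentumSection {y : Fin 3 → ℝ} (hL : 0 < 2 * y 0 + y 1 + y 2)
    (hy : ∀ A, 0 ≤ normal A ⬝ᵥ y) : momentum (momentumSection y) = y := by
  obtain ⟨h0, h1, h2, h3⟩ := mem_closedCone.1 hy
  have e1 : Real.cos (momentumSection y 1) = -(y 1 + y 2) / (2 * y 0 + y 1 + y 2) :=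
    Real.cos_arccos (by rw [le_div_iff₀ hL]; linarith) (by rw [div_le_iff₀ hL]; linarith)
  have e2 : Real.cos (momentumSection y 2) = (y 1 - y 2) / (2 * y 0 + y 1 + y 2) :=
    Real.cos_arccos (by rw [le_div_iff₀ hL]; linarith) (by rw [div_le_iff₀ hL]; linarith)
  have e0 : momentumSection y 0 ^ 2 = 3 * (2 * y 0 + y 1 + y 2) := Real.sq_sqrt (by positivity)
  rw [momentum_eq, e0, e1, e2]
  ext i
  fin_cases i <;> simp <;> field_simp <;> ring

/-- The four facets are the poles of the two spheres. The last form is the sum of either pair of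
opposite facet forms, and both B and B^can are multiples of it. -/
lemma momentum_linear_forms (p : Coord) :
    momentum p 0 + momentum p 1 + momentum p 2 = p 0 ^ 2 / 6 * (1 - Real.cos (p 1)) ∧
    momentum p 0 + momentum p 2 = p 0 ^ 2 / 6 * (1 - Real.cos (p 2)) ∧
    momentum p 0 = p 0 ^ 2 / 6 * (1 + Real.cos (p 1)) ∧
    momentum p 0 + momentum p 1 = p 0 ^ 2 / 6 * (1 + Real.cos (p 2)) ∧
    2 * momentum p 0 + momentum p 1 + momentum p 2 = p 0 ^ 2 / 3 := by
  rw [momentum_eq]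
  refine ⟨?_, ?_, ?_, ?_, ?_⟩ <;> simp <;> ring

lemma momentum_mem_openCone {p : Coord} (hp : p ∈ patch) : momentum p ∈ openCone := by
  obtain ⟨h0, h1, h2, h3, -⟩ := momentum_linear_forms p
  have := hp.1
  obtain ⟨a1, b1⟩ := patch_cos_one hp
  obtain ⟨a2, b2⟩ := patch_cos_two hp
  rw [mem_openCone, h0, h1, h3, h2]
  refine ⟨mul_pos (by positivity) ?_, mul_pos (by positivity) ?_, mul_pos (by positivity) ?_,
    mul_pos (by positivity) ?_⟩ <;> linarith

lemma momentumSection_mem_patch {y : Fin 3 → ℝ} (hy : y ∈ openCone) :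
    momentumSection y ∈ patch := by
  obtain ⟨h0, h1, h2, h3⟩ := mem_openCone.1 hy
  have hL : 0 < 2 * y 0 + y 1 + y 2 := by linarith
  refine ⟨Real.sqrt_pos.2 (by positivity), ⟨Real.arccos_pos.2 ?_, Real.arccos_lt_pi.2 ?_⟩,
    ⟨Real.arccos_pos.2 ?_, Real.arccos_lt_pi.2 ?_⟩⟩
  all_goals first | (rw [div_lt_iff₀ hL]; linarith) | (rw [lt_div_iff₀ hL]; linarith)

lemma momentum_image_patch : momentum '' patch = openCone := by
  refine Set.Subset.antisymm (Set.image_subset_iff.2 fun p hp => momentum_mem_openCone hp) ?_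
  intro y hy
  obtain ⟨h0, h1, h2, h3⟩ := mem_openCone.1 hy
  exact ⟨_, momentumSection_mem_patch hy,
    momentum_momentumSection (by linarith) fun A => (hy A).le⟩

lemma momentum_image_closedPatch :
    momentum '' closedPatch = {y | y ≠ 0 ∧ ∀ A, 0 ≤ normal A ⬝ᵥ y} := by
  refine Set.Subset.antisymm ?_ ?_
  · rintro _ ⟨p, hp, rfl⟩
    obtain ⟨h0, h1, h2, h3, h4⟩ := momentum_linear_forms p
    have hr : 0 < p 0 := hp.1
    refine ⟨fun h => ?_, mem_closedCone.2 ?_⟩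
    · rw [h] at h4
      have := sq_pos_of_pos hr
      simp at h4
      linarith
    · rw [h0, h1, h3, h2]
      refine ⟨mul_nonneg (by positivity) ?_, mul_nonneg (by positivity) ?_,
        mul_nonneg (by positivity) ?_, mul_nonneg (by positivity) ?_⟩ <;>
      linarith [Real.cos_le_one (p 1), Real.cos_le_one (p 2), Real.neg_one_le_cos (p 1),
        Real.neg_one_le_cos (p 2)]
  · rintro y ⟨hy0, hy⟩
    obtain ⟨h0, h1, h2, h3⟩ := mem_closedCone.1 hy
    have hL : 0 < 2 * y 0 + y 1 + y 2 := by
      -- This form is the sum of either opposite pair of nonnegative facet forms. If it is not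
      -- positive, all four vanish and y = 0.
      by_contra hL
      apply hy0
      ext i
      fin_cases i <;> simp <;> linarith
    exact ⟨momentumSection y, ⟨Real.sqrt_pos.2 (by positivity), ⟨Real.arccos_nonneg _,
      Real.arccos_le_pi _⟩, ⟨Real.arccos_nonneg _, Real.arccos_le_pi _⟩⟩,
      momentum_momentumSection hL hy⟩

/-! ### The symplectic potential -/

/-- The continuous linear form `y ↦ ⟨v, y⟩`. -/
def dotL (v : Fin 3 → ℝ) : (Fin 3 → ℝ) →L[ℝ] ℝ :=
  ∑ i, v i • ContinuousLinearMap.proj (R := ℝ) (φ := fun _ : Fin 3 => ℝ) i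

lemma dotL_apply (v y : Fin 3 → ℝ) : dotL v y = v ⬝ᵥ y := by
  simp [dotL, dotProduct]

lemma hasFDerivAt_dotProduct (v y : Fin 3 → ℝ) : HasFDerivAt (fun y => v ⬝ᵥ y) (dotL v) y := by
  simpa only [← dotL_apply] using (dotL v).hasFDerivAt

lemma hasFDerivAt_log_dotProduct {v y : Fin 3 → ℝ} (h : v ⬝ᵥ y ≠ 0) :
    HasFDerivAt (fun y => Real.log (v ⬝ᵥ y)) ((v ⬝ᵥ y)⁻¹ • dotL v) y :=
  (hasFDerivAt_dotProduct v y).log h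

lemma hasFDerivAt_mul_log_dotProduct {v y : Fin 3 → ℝ} (h : v ⬝ᵥ y ≠ 0) :
    HasFDerivAt (fun y => 1 / 2 * (v ⬝ᵥ y) * Real.log (v ⬝ᵥ y))
      ((1 / 2 * (Real.log (v ⬝ᵥ y) + 1)) • dotL v) y := by
  refine (((hasFDerivAt_dotProduct v y).const_mul (1 / 2 : ℝ)).mul
    (hasFDerivAt_log_dotProduct h)).congr_fderiv ?_
  ext w
  simp
  field_simp
  ring

lemma contDiffAt_mul_log_dotProduct {v y : Fin 3 → ℝ} (h : v ⬝ᵥ y ≠ 0) :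
    ContDiffAt ℝ ∞ (fun y => 1 / 2 * (v ⬝ᵥ y) * Real.log (v ⬝ᵥ y)) y := by
  have : ContDiffAt ℝ ∞ (fun y => v ⬝ᵥ y) y := by
    simpa only [← dotL_apply] using (dotL v).contDiff.contDiffAt
  exact (contDiffAt_const.mul this).mul (this.log h)

section openCone

variable {y : Fin 3 → ℝ} (hy : y ∈ openCone)
include hy

lemma openCone_sum_pos : 0 < 2 * y 0 + y 1 + y 2 := by
  obtain ⟨h0, h1, h2, h3⟩ := mem_openCone.1 hy
  linarith

lemma reebVec_pos : 0 < reebVec ⬝ᵥ y := by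
  have := openCone_sum_pos hy
  rw [reebVec_dotProduct]; positivity

lemma canVec_pos : 0 < canVec ⬝ᵥ y := by
  have := openCone_sum_pos hy
  rw [canVec_dotProduct]; positivity

lemma contDiffAt_G : ContDiffAt ℝ ∞ G y := by
  have h := ((ContDiffAt.sum (s := Finset.univ)
    fun A _ => contDiffAt_mul_log_dotProduct (hy A).ne').add
    ((contDiffAt_mul_log_dotProduct (reebVec_pos hy).ne').sub
      (contDiffAt_mul_log_dotProduct (canVec_pos hy).ne')))
  refine h.congr_of_eventuallyEq (Filter.Eventually.of_forall fun z => ?_)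
  simp [G, Gcan, GB]

end openCone

/-- The explicit gradient of the symplectic potential. -/
def gradientG (y : Fin 3 → ℝ) (i : Fin 3) : ℝ :=
  1 / 2 * ((∑ A, normal A i * Real.log (normal A ⬝ᵥ y)) + reebVec i * Real.log (reebVec ⬝ᵥ y)
    - canVec i * Real.log (canVec ⬝ᵥ y) + reebVec i)

lemma hasFDerivAt_G {y : Fin 3 → ℝ} (hy : y ∈ openCone) :
    HasFDerivAt G (dotL (gradientG y)) y := by
  have h := ((HasFDerivAt.fun_sum (u := Finset.univ)
    fun A _ => hasFDerivAt_mul_log_dotProduct (hy A).ne').add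
    ((hasFDerivAt_mul_log_dotProduct (reebVec_pos hy).ne').sub
      (hasFDerivAt_mul_log_dotProduct (canVec_pos hy).ne')))
  refine h.congr_fderiv ?_
  ext w
  -- Each l log l contributes the constant 1 to its derivative; because B^can = ∑ v_A these
  -- constants cancel except for that of B.
  have hc : canVec ⬝ᵥ w = ∑ A, normal A ⬝ᵥ w := by rw [canVec, sum_dotProduct]
  simp only [add_apply, FunLike.coe_sum, Finset.sum_apply, smul_apply, sub_apply,
    dotL_apply, smul_eq_mul, hc]
  simp [dotProduct, gradientG, Fin.sum_univ_three, Fin.sum_univ_four, canVec]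
  ring

/-- The explicit Hessian of the symplectic potential. -/
def hessianG (y : Fin 3 → ℝ) (i j : Fin 3) : ℝ :=
  1 / 2 * ((∑ A, normal A i * normal A j / (normal A ⬝ᵥ y))
    + reebVec i * reebVec j / (reebVec ⬝ᵥ y) - canVec i * canVec j / (canVec ⬝ᵥ y))

lemma hasFDerivAt_gradientG {y : Fin 3 → ℝ} (hy : y ∈ openCone) (i : Fin 3) :
    HasFDerivAt (fun y => gradientG y i) (dotL (hessianG y i)) y := by
  have h := ((((HasFDerivAt.fun_sum (u := Finset.univ)
    fun A _ => (hasFDerivAt_log_dotProduct (hy A).ne').const_mul (normal A i)).add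
    ((hasFDerivAt_log_dotProduct (reebVec_pos hy).ne').const_mul (reebVec i))).sub
      ((hasFDerivAt_log_dotProduct (canVec_pos hy).ne').const_mul (canVec i))).add_const
      (reebVec i)).const_mul (1 / 2 : ℝ)
  refine h.congr_fderiv ?_
  ext w
  simp only [add_apply, FunLike.coe_sum, Finset.sum_apply, smul_apply, sub_apply,
    dotL_apply, smul_eq_mul]
  simp [dotProduct, hessianG, Fin.sum_univ_three, Fin.sum_univ_four]
  ring

lemma gradG_eq {y : Fin 3 → ℝ} (hy : y ∈ openCone) : gradG y = gradientG y := by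
  ext i
  rw [gradG, pd, (hasFDerivAt_G hy).fderiv, dotL_apply]
  simp

lemma hessG_apply {y : Fin 3 → ℝ} (hy : y ∈ openCone) (i j : Fin 3) :
    hessG y i j = hessianG y i j := by
  have h : pd j G =ᶠ[nhds y] fun z => gradientG z j := by
    filter_upwards [openCone_isOpen.mem_nhds hy] with z hz
    exact congrFun (gradG_eq hz) j
  have e : hessianG y i j = hessianG y j i := by
    simp [hessianG, mul_comm]
  rw [hessG, Matrix.of_apply, pd, h.fderiv_eq, (hasFDerivAt_gradientG hy j).fderiv, dotL_apply, e]
  simp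

/-- Cauchy–Schwarz with weights; the defect is a multiple of (am - bl)². -/
lemma add_sq_div_le (a b : ℝ) {l m : ℝ} (hl : 0 < l) (hm : 0 < m) :
    (a + b) ^ 2 / (l + m) ≤ a ^ 2 / l + b ^ 2 / m := by
  rw [div_add_div _ _ hl.ne' hm.ne', div_le_div_iff₀ (by positivity) (by positivity)]
  nlinarith [mul_nonneg (mul_pos hl hm).le (sq_nonneg (a * m - b * l)), sq_nonneg (a * m - b * l)]

section openCone

variable {y : Fin 3 → ℝ} (hy : y ∈ openCone)
include hy

/-- The Hessian of the symplectic potential as a sum over facets. -/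
lemma hessianG_eq (i j : Fin 3) :
    hessianG y i j = 1 / 2 * (normal 0 i * normal 0 j / (y 0 + y 1 + y 2)
      + normal 1 i * normal 1 j / (y 0 + y 2) + normal 2 i * normal 2 j / y 0
      + normal 3 i * normal 3 j / (y 0 + y 1)
      - reebVec i * reebVec j * (2 / 9) / (2 * y 0 + y 1 + y 2)) := by
  have hL := openCone_sum_pos hy
  obtain ⟨h0, h1, h2, h3⟩ := normal_dotProduct y
  -- For this cone B^can is parallel to B, so their two terms merge: 2/3 - 8/9 = -2/9.
  have hc : ∀ k, canVec k = 4 / 3 * reebVec k := by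
    intro k
    rw [canVec_eq]
    fin_cases k <;> simp [reebVec] <;> norm_num
  rw [hessianG, Fin.sum_univ_four, h0, h1, h2, h3, reebVec_dotProduct, canVec_dotProduct, hc, hc]
  field_simp
  ring

/-- By `add_sq_div_le` for the pairs v₁, v₃ and v₂, v₄, the square over 2y¹ + y² + y³ is at most the
contribution of either opposite pair. It enters with weight -1/2, so at least three quarters of the
facet sum survives, and the facet normals span. -/
lemma hessianG_pos {w : Fin 3 → ℝ} (hw : w ≠ 0) : 0 < w ⬝ᵥ fun i => hessianG y i ⬝ᵥ w := by
  obtain ⟨h0, h1, h2, h3⟩ := mem_openCone.1 hy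
  have hL := openCone_sum_pos hy
  have e : (w ⬝ᵥ fun i => hessianG y i ⬝ᵥ w) = 1 / 2 * ((w 0 + w 1 + w 2) ^ 2 / (y 0 + y 1 + y 2)
      + (w 0 + w 2) ^ 2 / (y 0 + y 2) + w 0 ^ 2 / y 0 + (w 0 + w 1) ^ 2 / (y 0 + y 1)
      - 1 / 2 * ((2 * w 0 + w 1 + w 2) ^ 2 / (2 * y 0 + y 1 + y 2))) := by
    simp only [dotProduct, Fin.sum_univ_three, hessianG_eq hy]
    simp [normal, reebVec]
    ring
  have k1 := add_sq_div_le (w 0 + w 1 + w 2) (w 0) h0 h2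
  have k2 := add_sq_div_le (w 0 + w 2) (w 0 + w 1) h1 h3
  rw [show w 0 + w 1 + w 2 + w 0 = 2 * w 0 + w 1 + w 2 by ring,
    show y 0 + y 1 + y 2 + y 0 = 2 * y 0 + y 1 + y 2 by ring] at k1
  rw [show w 0 + w 2 + (w 0 + w 1) = 2 * w 0 + w 1 + w 2 by ring,
    show y 0 + y 2 + (y 0 + y 1) = 2 * y 0 + y 1 + y 2 by ring] at k2
  have p0 : 0 ≤ (w 0 + w 1 + w 2) ^ 2 / (y 0 + y 1 + y 2) := by positivity
  have p1 : 0 ≤ (w 0 + w 2) ^ 2 / (y 0 + y 2) := by positivity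
  have p2 : 0 ≤ w 0 ^ 2 / y 0 := by positivity
  have p3 : 0 ≤ (w 0 + w 1) ^ 2 / (y 0 + y 1) := by positivity
  rw [e]
  by_contra hn
  apply hw
  have q1 : (w 0 + w 2) ^ 2 / (y 0 + y 2) = 0 := by linarith
  have q2 : w 0 ^ 2 / y 0 = 0 := by linarith
  have q3 : (w 0 + w 1) ^ 2 / (y 0 + y 1) = 0 := by linarith
  simp only [div_eq_zero_iff, h1.ne', h2.ne', h3.ne', or_false, ne_eq, OfNat.ofNat_ne_zero,
    not_false_eq_true, pow_eq_zero_iff] at q1 q2 q3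
  ext i
  fin_cases i <;> simp <;> linarith

lemma hessG_posDef : (hessG y).PosDef := by
  rw [Matrix.posDef_iff_dotProduct_mulVec]
  refine ⟨?_, fun w hw => ?_⟩
  · ext i j
    simp [hessG_apply hy, hessianG_eq hy, mul_comm]
  · have : star w ⬝ᵥ Matrix.mulVec (hessG y) w = w ⬝ᵥ fun i => hessianG y i ⬝ᵥ w := by
      simp only [star_trivial]
      congr 1
      ext i
      simp only [Matrix.mulVec, dotProduct, hessG_apply hy]
    rw [this]
    exact hessianG_pos hy hw

/-- A term ½ l log l with l = ⟨v, y⟩ has Hessian v vᵀ/(2l), which sends y to v/2. Summing, ∑ v_A + B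
- B^can = B. -/
lemma reebVec_eq_hessG_mulVec : reebVec = (2 : ℝ) • Matrix.mulVec (hessG y) y := by
  obtain ⟨h0, h1, h2, h3⟩ := mem_openCone.1 hy
  have hL := openCone_sum_pos hy
  ext i
  simp only [Pi.smul_apply, Matrix.mulVec, dotProduct, Fin.sum_univ_three, hessG_apply hy,
    hessianG_eq hy, smul_eq_mul]
  fin_cases i <;> simp [normal, reebVec] <;> field_simp <;> ring

lemma hessG_det : (hessG y).det = 3 / 16 * (2 * y 0 + y 1 + y 2)
    / ((y 0 + y 1 + y 2) * (y 0 + y 2) * y 0 * (y 0 + y 1)) := by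
  obtain ⟨h0, h1, h2, h3⟩ := mem_openCone.1 hy
  have hL := openCone_sum_pos hy
  rw [Matrix.det_fin_three]
  simp only [hessG_apply hy, hessianG_eq hy]
  simp [normal, reebVec]
  field_simp
  ring

/-- The first components are 1 for every v_A, 3 for B and 4 for B^can. With L = 2y¹ + y² + y³ this
leaves (2L)⁴/(3L/2)³ = (128/27) L over the product of the facet forms. -/
lemma exp_gradG : Real.exp (-2 * gradG y 0) = Real.exp (-3) * (128 / 27) *
    ((2 * y 0 + y 1 + y 2) / ((y 0 + y 1 + y 2) * (y 0 + y 2) * y 0 * (y 0 + y 1))) := by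
  obtain ⟨h0, h1, h2, h3⟩ := mem_openCone.1 hy
  have hL := openCone_sum_pos hy
  obtain ⟨e0, e1, e2, e3⟩ := normal_dotProduct y
  have e : -2 * gradG y 0 = -3 + (4 * Real.log (2 * (2 * y 0 + y 1 + y 2))
      - (Real.log (y 0 + y 1 + y 2) + Real.log (y 0 + y 2) + Real.log (y 0) + Real.log (y 0 + y 1))
      - 3 * Real.log (3 / 2 * (2 * y 0 + y 1 + y 2))) := by
    rw [gradG_eq hy, gradientG, Fin.sum_univ_four, e0, e1, e2, e3, reebVec_dotProduct,
      canVec_dotProduct, canVec_eq]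
    simp [normal, reebVec]
    ring
  have x4 : ∀ {a : ℝ}, 0 < a → Real.exp (4 * Real.log a) = a ^ 4 := fun {a} h => by
    rw [show 4 * Real.log a = (4 : ℕ) * Real.log a by norm_num, Real.exp_nat_mul, Real.exp_log h]
  have x3 : ∀ {a : ℝ}, 0 < a → Real.exp (3 * Real.log a) = a ^ 3 := fun {a} h => by
    rw [show 3 * Real.log a = (3 : ℕ) * Real.log a by norm_num, Real.exp_nat_mul, Real.exp_log h]
  rw [e, Real.exp_add, Real.exp_sub, Real.exp_sub, x4 (by positivity), x3 (by positivity),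
    Real.exp_add, Real.exp_add, Real.exp_add, Real.exp_log h0, Real.exp_log h1, Real.exp_log h2,
    Real.exp_log h3]
  field_simp
  ring

lemma monge_ampere :
    (hessG y).det = 81 * Real.exp 3 / 2 ^ 11 * Real.exp (-2 * gradG y 0) := by
  have : Real.exp 3 * Real.exp (-3) = 1 := by rw [← Real.exp_add]; simp
  rw [hessG_det hy, exp_gradG hy]
  linear_combination (-(3 / 16) * (2 * y 0 + y 1 + y 2)
    / ((y 0 + y 1 + y 2) * (y 0 + y 2) * y 0 * (y 0 + y 1))) * this

end openCone

/-! ### Strict convexity of the symplectic potential -/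

/-- A function on an open convex set with positive definite second derivative is strictly
convex. -/
lemma strictConvexOn_of_hasFDerivAt {E : Type*} [NormedAddCommGroup E] [NormedSpace ℝ E]
    {s : Set E} (hs : IsOpen s) (hc : Convex ℝ s) {f : E → ℝ} {f' : E → E →L[ℝ] ℝ}
    {f'' : E → E → E →L[ℝ] ℝ} (h1 : ∀ x ∈ s, HasFDerivAt f (f' x) x)
    (h2 : ∀ x ∈ s, ∀ v, HasFDerivAt (fun y => f' y v) (f'' x v) x)
    (hpos : ∀ x ∈ s, ∀ v, v ≠ 0 → 0 < f'' x v v) : StrictConvexOn ℝ s f := by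
  refine ⟨hc, fun x hx y hy hxy a b ha hb hab => ?_⟩
  -- Restriction to the line through x and y reduces the claim to the one-variable second derivative
  -- test.
  set l : ℝ → E := ⇑(AffineMap.lineMap (k := ℝ) x y) with hl
  have hld (t : ℝ) : HasDerivAt l (y - x) t := AffineMap.hasDerivAt_lineMap
  set D : Set ℝ := l ⁻¹' s with hD
  have hDo : IsOpen D := hs.preimage AffineMap.lineMap_continuous
  have hDc : Convex ℝ D := hc.affine_preimage (AffineMap.lineMap x y : ℝ →ᵃ[ℝ] E)
  have d1 : ∀ t ∈ D, HasDerivAt (f ∘ l) (f' (l t) (y - x)) t := fun t ht =>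
    (h1 _ ht).comp_hasDerivAt t (hld t)
  have d2 : ∀ t ∈ D, HasDerivAt (fun t => f' (l t) (y - x)) (f'' (l t) (y - x) (y - x)) t :=
    fun t ht => (h2 _ ht (y - x)).comp_hasDerivAt t (hld t)
  have hφ : StrictConvexOn ℝ D (f ∘ l) := by
    refine strictConvexOn_of_deriv2_pos hDc
      (fun t ht => (d1 t ht).continuousAt.continuousWithinAt) fun t ht => ?_
    have ht : t ∈ D := interior_subset ht
    have e : deriv (f ∘ l) =ᶠ[nhds t] fun t => f' (l t) (y - x) := by
      filter_upwards [hDo.mem_nhds ht] with u hu using (d1 u hu).deriv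
    rw [Function.iterate_succ, Function.iterate_one, Function.comp_apply, e.deriv_eq,
      (d2 t ht).deriv]
    exact hpos _ ht _ (sub_ne_zero.2 hxy.symm)
  have h0 : l 0 = x := AffineMap.lineMap_apply_zero x y
  have h1' : l 1 = y := AffineMap.lineMap_apply_one x y
  have hab' : l (a • 0 + b • 1) = a • x + b • y := by
    rw [hl, AffineMap.lineMap_apply_module']
    obtain rfl : a = 1 - b := by linarith
    simp only [smul_eq_mul, mul_zero, mul_one, zero_add]
    module
  have := hφ.2 (show (0 : ℝ) ∈ D by simpa [hD, h0]) (show (1 : ℝ) ∈ D by simpa [hD, h1'])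
    zero_ne_one ha hb hab
  simpa only [Function.comp_apply, hab', h0, h1'] using this

lemma strictConvexOn_G : StrictConvexOn ℝ openCone G := by
  refine strictConvexOn_of_hasFDerivAt (f' := fun y => dotL (gradientG y))
    (f'' := fun y v => dotL fun k => v ⬝ᵥ fun i => hessianG y i k) openCone_isOpen openCone_convex
    (fun y hy => hasFDerivAt_G hy) (fun y hy v => ?_) fun y hy v hv => ?_
  · have h := HasFDerivAt.fun_sum (u := Finset.univ)
      fun i _ => (hasFDerivAt_gradientG hy i).mul_const (v i)
    have e : (fun z => dotL (gradientG z) v) = fun z => ∑ i, gradientG z i * v i := by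
      ext z; simp [dotL_apply, dotProduct]
    rw [e]
    refine h.congr_fderiv ?_
    ext w
    simp [dotL_apply, dotProduct, Fin.sum_univ_three]
    ring
  · have := hessianG_pos hy hv
    rw [dotL_apply]
    convert this using 1
    simp [dotProduct, Fin.sum_univ_three]
    ring

/-! ### The complex coordinates -/

/-- The real parts of the complex coordinates. -/
def logRadii (p : Coord) : Fin 3 → ℝ :=
  ![3 * Real.log (p 0) + Real.log (Real.sin (p 1)) + Real.log (Real.sin (p 2)),
    3 / 2 * Real.log (p 0) + Real.log (Real.sin (p 1 / 2)) + Real.log (Real.cos (p 2 / 2)),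
    3 / 2 * Real.log (p 0) + Real.log (Real.sin (p 1 / 2)) + Real.log (Real.sin (p 2 / 2))]

lemma zc_eq (p : Coord) (i : Fin 3) :
    zc p i = (logRadii p i : ℂ) + Complex.I * (angle p i : ℂ) := by
  fin_cases i <;> simp [zc, logRadii, angle] <;> ring

section patch

variable {p : Coord} (hp : p ∈ patch)
include hp

lemma patch_half : (0 < Real.sin (p 1 / 2) ∧ 0 < Real.cos (p 1 / 2)) ∧
    (0 < Real.sin (p 2 / 2) ∧ 0 < Real.cos (p 2 / 2)) := by
  obtain ⟨-, ⟨h1, h2⟩, h3, h4⟩ := hp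
  refine ⟨⟨Real.sin_pos_of_pos_of_lt_pi ?_ ?_, Real.cos_pos_of_mem_Ioo ⟨?_, ?_⟩⟩,
    ⟨Real.sin_pos_of_pos_of_lt_pi ?_ ?_, Real.cos_pos_of_mem_Ioo ⟨?_, ?_⟩⟩⟩ <;> linarith

end patch

lemma sin_eq_half (x : ℝ) : Real.sin x = 2 * Real.sin (x / 2) * Real.cos (x / 2) := by
  rw [← Real.sin_two_mul]; ring_nf

lemma one_add_cos_eq_half (x : ℝ) : 1 + Real.cos x = 2 * Real.cos (x / 2) ^ 2 := by
  have := Real.cos_two_mul (x / 2)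
  rw [show 2 * (x / 2) = x by ring] at this
  rw [this]; ring

lemma one_sub_cos_eq_half (x : ℝ) : 1 - Real.cos x = 2 * Real.sin (x / 2) ^ 2 := by
  have := one_add_cos_eq_half x
  have := Real.sin_sq_add_cos_sq (x / 2)
  linarith

lemma log_sin_eq_half {x : ℝ} (hs : 0 < Real.sin (x / 2)) (hc : 0 < Real.cos (x / 2)) :
    Real.log (Real.sin x)
      = Real.log 2 + Real.log (Real.sin (x / 2)) + Real.log (Real.cos (x / 2)) := by
  rw [sin_eq_half, Real.log_mul (by positivity) hc.ne', Real.log_mul two_ne_zero hs.ne']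

lemma log_tan_half {x : ℝ} (hs : 0 < Real.sin (x / 2)) (hc : 0 < Real.cos (x / 2)) :
    Real.log (Real.tan (x / 2)) = Real.log (Real.sin (x / 2)) - Real.log (Real.cos (x / 2)) := by
  rw [Real.tan_eq_sin_div_cos, Real.log_div hs.ne' hc.ne']

/-- In these combinations log r cancels, so each angle is read off separately; 2 log 2 comes from
the two double-angle formulas. -/
lemma logRadii_tan {p : Coord} (hp : p ∈ patch) :
    Real.log (Real.tan (p 2 / 2)) = logRadii p 2 - logRadii p 1 ∧
    Real.log (Real.tan (p 1 / 2))
      = logRadii p 1 + logRadii p 2 - logRadii p 0 + 2 * Real.log 2 := by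
  obtain ⟨⟨a, b⟩, c, d⟩ := patch_half hp
  rw [log_tan_half a b, log_tan_half c d]
  constructor
  · simp [logRadii]
  · simp [logRadii, log_sin_eq_half a b, log_sin_eq_half c d]
    ring

lemma tan_half_injective {a b : ℝ} (ha : 0 < a ∧ a < Real.pi) (hb : 0 < b ∧ b < Real.pi)
    (h : Real.log (Real.tan (a / 2)) = Real.log (Real.tan (b / 2))) : a = b := by
  have ta : 0 < Real.tan (a / 2) :=
    Real.tan_pos_of_pos_of_lt_pi_div_two (by linarith) (by linarith)
  have tb : 0 < Real.tan (b / 2) :=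
    Real.tan_pos_of_pos_of_lt_pi_div_two (by linarith) (by linarith)
  have := Real.injOn_tan ⟨by linarith, by linarith⟩ ⟨by linarith, by linarith⟩
    (Real.log_injOn_pos ta tb h)
  linarith

lemma logRadii_injective {p q : Coord} (hp : p ∈ patch) (hq : q ∈ patch)
    (h : logRadii p = logRadii q) : p 0 = q 0 ∧ p 1 = q 1 ∧ p 2 = q 2 := by
  obtain ⟨p2, p1⟩ := logRadii_tan hp
  obtain ⟨q2, q1⟩ := logRadii_tan hq
  have e2 : p 2 = q 2 := tan_half_injective hp.2.2 hq.2.2 (by rw [p2, q2, h])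
  have e1 : p 1 = q 1 := tan_half_injective hp.2.1 hq.2.1 (by rw [p1, q1, h])
  refine ⟨Real.log_injOn_pos hp.1 hq.1 ?_, e1, e2⟩
  have := congrFun h 0
  simp [logRadii, e1, e2] at this
  exact this

lemma logRadii_angle_surjective (u a : Fin 3 → ℝ) :
    ∃ p ∈ patch, logRadii p = u ∧ angle p = a := by
  have hθ (t : ℝ) : 0 < 2 * Real.arctan (Real.exp t) ∧ 2 * Real.arctan (Real.exp t) < Real.pi := by
    have h1 := Real.arctan_pos.2 (Real.exp_pos t)
    have h2 := Real.arctan_lt_pi_div_two (Real.exp t)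
    constructor <;> linarith
  -- The angles solve `logRadii_tan`; r is then chosen to match the first component, and φ₁ = Φ¹ -
  -- Φ² - Φ³, φ₂ = Φ² - Φ³.
  set θ₁ := 2 * Real.arctan (Real.exp (u 1 + u 2 - u 0 + 2 * Real.log 2)) with h1
  set θ₂ := 2 * Real.arctan (Real.exp (u 2 - u 1)) with h2
  set s := Real.exp ((u 0 - Real.log (Real.sin θ₁) - Real.log (Real.sin θ₂)) / 3) with hs
  set p : Coord := ![s, θ₁, θ₂, a 0 - a 1 - a 2, a 1 - a 2, a 0] with hpd
  have hp : p ∈ patch := ⟨Real.exp_pos _, hθ _, hθ _⟩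
  have e0 : logRadii p 0 = u 0 := by
    have : Real.log s = (u 0 - Real.log (Real.sin θ₁) - Real.log (Real.sin θ₂)) / 3 :=
      Real.log_exp _
    simp only [logRadii, Matrix.cons_val_zero]
    change 3 * Real.log s + Real.log (Real.sin θ₁) + Real.log (Real.sin θ₂) = u 0
    rw [this]; ring
  obtain ⟨p2, p1⟩ := logRadii_tan hp
  have t1 : Real.log (Real.tan (p 1 / 2)) = u 1 + u 2 - u 0 + 2 * Real.log 2 := by
    change Real.log (Real.tan (θ₁ / 2)) = _
    rw [h1, mul_div_cancel_left₀ _ two_ne_zero, Real.tan_arctan, Real.log_exp]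
  have t2 : Real.log (Real.tan (p 2 / 2)) = u 2 - u 1 := by
    change Real.log (Real.tan (θ₂ / 2)) = _
    rw [h2, mul_div_cancel_left₀ _ two_ne_zero, Real.tan_arctan, Real.log_exp]
  refine ⟨p, hp, ?_, ?_⟩
  · ext i
    fin_cases i <;> simp <;> linarith
  · ext i
    fin_cases i <;> simp [angle, hpd] <;> ring

/-- The gradient of the symplectic potential along the momentum map. -/
lemma gradG_momentum {p : Coord} (hp : p ∈ patch) (i : Fin 3) :
    gradG (momentum p) i = logRadii p i + shift i := by
  have hr := hp.1
  obtain ⟨⟨a, b⟩, c, d⟩ := patch_half hp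
  obtain ⟨f0, f1, f2, f3, f4⟩ := momentum_linear_forms p
  obtain ⟨e0, e1, e2, e3⟩ := normal_dotProduct (momentum p)
  -- All log 3 terms cancel since B^can = ∑ v_A; the remaining log 2 terms and the constant B/2 make
  -- up `shift`.
  have key {t : ℝ} (ht : 0 < t) : Real.log (p 0 ^ 2 / 6 * (2 * t ^ 2))
      = 2 * Real.log (p 0) - Real.log 3 + 2 * Real.log t := by
    rw [show p 0 ^ 2 / 6 * (2 * t ^ 2) = p 0 ^ 2 / 3 * t ^ 2 by ring,
      Real.log_mul (by positivity) (by positivity), Real.log_div (by positivity) (by positivity)]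
    simp
  have kB : Real.log (3 / 2 * (p 0 ^ 2 / 3)) = 2 * Real.log (p 0) - Real.log 2 := by
    rw [show 3 / 2 * (p 0 ^ 2 / 3) = p 0 ^ 2 / 2 by ring,
      Real.log_div (by positivity) (by positivity)]
    simp
  have kC : Real.log (2 * (p 0 ^ 2 / 3)) = Real.log 2 + 2 * Real.log (p 0) - Real.log 3 := by
    rw [Real.log_mul (by positivity) (by positivity), Real.log_div (by positivity) (by positivity)]
    simp
    ring
  rw [gradG_eq (momentum_mem_openCone hp), gradientG, Fin.sum_univ_four, e0, e1, e2, e3,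
    reebVec_dotProduct, canVec_dotProduct, f4, f0, f1, f3, f2, one_add_cos_eq_half,
    one_add_cos_eq_half, one_sub_cos_eq_half, one_sub_cos_eq_half, key a, key b, key c, key d,
    kB, kC, canVec_eq]
  fin_cases i <;> simp [normal, reebVec, logRadii, shift, log_sin_eq_half a b,
    log_sin_eq_half c d] <;> ring

/-- Pulled back along the surjection `momentum`, the Legendre map is a translate of `logRadii`,
which is onto and determines r, θ₁, θ₂, hence y. -/
lemma gradG_bijOn : Set.BijOn gradG openCone Set.univ := by
  refine ⟨fun _ _ => Set.mem_univ _, fun y hy z hz h => ?_, fun x _ => ?_⟩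
  · rw [← momentum_image_patch] at hy hz
    obtain ⟨p, hp, rfl⟩ := hy
    obtain ⟨q, hq, rfl⟩ := hz
    have e : logRadii p = logRadii q := by
      ext i
      have := congrFun h i
      rwa [gradG_momentum hp, gradG_momentum hq, add_left_inj] at this
    obtain ⟨a, b, c⟩ := logRadii_injective hp hq e
    rw [momentum_eq, momentum_eq, a, b, c]
  · obtain ⟨p, hp, hu, -⟩ := logRadii_angle_surjective (fun i => x i - shift i) 0
    refine ⟨momentum p, momentum_mem_openCone hp, ?_⟩
    ext i
    rw [gradG_momentum hp, hu]
    ring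

lemma zc_eq_gradG {p : Coord} (hp : p ∈ patch) (i : Fin 3) :
    zc p i = ((gradG (momentum p) i - shift i : ℝ) : ℂ) + Complex.I * (angle p i : ℂ) := by
  rw [zc_eq, gradG_momentum hp, add_sub_cancel_right]

lemma zc_re_im (p : Coord) (i : Fin 3) :
    (zc p i).re = logRadii p i ∧ (zc p i).im = angle p i := by
  rw [zc_eq]
  simp

lemma zc_bijOn : Set.BijOn zc patch Set.univ := by
  refine ⟨fun _ _ => Set.mem_univ _, fun p hp q hq h => ?_, fun w _ => ?_⟩
  · have e : logRadii p = logRadii q := by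
      ext i
      rw [← (zc_re_im p i).1, h, (zc_re_im q i).1]
    have e' : ∀ i, angle p i = angle q i := fun i => by
      rw [← (zc_re_im p i).2, h, (zc_re_im q i).2]
    obtain ⟨a, b, c⟩ := logRadii_injective hp hq e
    have a0 := e' 0
    have a1 := e' 1
    have a2 := e' 2
    simp [angle] at a0 a1 a2
    ext k
    fin_cases k <;> simp <;> linarith
  · obtain ⟨p, hp, hu, ha⟩ := logRadii_angle_surjective (fun i => (w i).re) (fun i => (w i).im)
    refine ⟨p, hp, ?_⟩
    ext i
    rw [zc_eq, hu, ha, mul_comm]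
    exact Complex.re_add_im _

/-! ### The Kähler potential -/

/-- The cube of the radius as a function of the real parts of the complex coordinates. -/
def radiusCubed (u : Fin 3 → ℝ) : ℝ :=
  (1 + Real.exp (2 * (u 0 - u 1 - u 2)) / 16) * (Real.exp (2 * u 1) + Real.exp (2 * u 2))

lemma radiusCubed_pos (u : Fin 3 → ℝ) : 0 < radiusCubed u := by
  unfold radiusCubed
  positivity

lemma exp_logRadii {p : Coord} (hp : p ∈ patch) :
    Real.exp (2 * logRadii p 1) = p 0 ^ 3 * Real.sin (p 1 / 2) ^ 2 * Real.cos (p 2 / 2) ^ 2 ∧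
    Real.exp (2 * logRadii p 2) = p 0 ^ 3 * Real.sin (p 1 / 2) ^ 2 * Real.sin (p 2 / 2) ^ 2 ∧
    Real.exp (2 * (logRadii p 0 - logRadii p 1 - logRadii p 2))
      = 16 * (Real.cos (p 1 / 2) ^ 2 / Real.sin (p 1 / 2) ^ 2) := by
  have hr := hp.1
  obtain ⟨⟨a, b⟩, c, d⟩ := patch_half hp
  have x2 {t : ℝ} (ht : 0 < t) : Real.exp (2 * Real.log t) = t ^ 2 := by
    rw [show 2 * Real.log t = (2 : ℕ) * Real.log t by norm_num, Real.exp_nat_mul, Real.exp_log ht]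
  have x3 {t : ℝ} (ht : 0 < t) : Real.exp (3 * Real.log t) = t ^ 3 := by
    rw [show 3 * Real.log t = (3 : ℕ) * Real.log t by norm_num, Real.exp_nat_mul, Real.exp_log ht]
  have e1 : 2 * logRadii p 1 = 3 * Real.log (p 0) + 2 * Real.log (Real.sin (p 1 / 2))
      + 2 * Real.log (Real.cos (p 2 / 2)) := by simp [logRadii]; ring
  have e2 : 2 * logRadii p 2 = 3 * Real.log (p 0) + 2 * Real.log (Real.sin (p 1 / 2))
      + 2 * Real.log (Real.sin (p 2 / 2)) := by simp [logRadii]; ring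
  have e3 : 2 * (logRadii p 0 - logRadii p 1 - logRadii p 2)
      = 2 * Real.log 2 + 2 * Real.log 2 + (2 * Real.log (Real.cos (p 1 / 2))
        - 2 * Real.log (Real.sin (p 1 / 2))) := by
    simp [logRadii, log_sin_eq_half a b, log_sin_eq_half c d]; ring
  refine ⟨?_, ?_, ?_⟩
  · rw [e1, Real.exp_add, Real.exp_add, x3 hr, x2 a, x2 d]
  · rw [e2, Real.exp_add, Real.exp_add, x3 hr, x2 a, x2 c]
  · rw [e3, Real.exp_add, Real.exp_add, Real.exp_sub, x2 two_pos, x2 b, x2 a]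
    norm_num

/-- The second factor is r³ sin²(θ₁/2) and the first is 1 + cot²(θ₁/2). -/
lemma radiusCubed_logRadii {p : Coord} (hp : p ∈ patch) : radiusCubed (logRadii p) = p 0 ^ 3 := by
  obtain ⟨⟨a, b⟩, c, d⟩ := patch_half hp
  obtain ⟨e1, e2, e3⟩ := exp_logRadii hp
  have h1 := Real.sin_sq_add_cos_sq (p 1 / 2)
  have h2 := Real.sin_sq_add_cos_sq (p 2 / 2)
  rw [radiusCubed, e1, e2, e3]
  field_simp
  linear_combination p 0 ^ 3 * h1
    + p 0 ^ 3 * (Real.sin (p 1 / 2) ^ 2 + Real.cos (p 1 / 2) ^ 2) * h2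

/-- The Kähler potential. -/
def kahlerPotential (x : Fin 3 → ℝ) : ℝ :=
  1 / 4 * radiusCubed (fun i => x i - shift i) ^ (2 / 3 : ℝ)

lemma contDiff_radiusCubed : ContDiff ℝ ∞ radiusCubed := by
  unfold radiusCubed
  fun_prop

lemma contDiff_kahlerPotential : ContDiff ℝ ∞ kahlerPotential := by
  have h : ContDiff ℝ ∞ fun x : Fin 3 → ℝ => radiusCubed (fun i => x i - shift i) :=
    contDiff_radiusCubed.comp (by fun_prop)
  exact contDiff_const.mul (h.rpow_const_of_ne fun x => (radiusCubed_pos _).ne')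

lemma shifted_gradG_momentum {p : Coord} (hp : p ∈ patch) :
    (fun i => gradG (momentum p) i - shift i) = logRadii p := by
  ext i
  rw [gradG_momentum hp, add_sub_cancel_right]

lemma kahlerPotential_gradG {p : Coord} (hp : p ∈ patch) :
    kahlerPotential (gradG (momentum p)) = p 0 ^ 2 / 4 := by
  have hr := hp.1
  rw [kahlerPotential, shifted_gradG_momentum hp, radiusCubed_logRadii hp,
    ← Real.rpow_natCast, ← Real.rpow_mul hr.le]
  norm_num
  ring

/-- Euler's operator minus the identity sends l log l to l, so only ½(∑ v_A + B - B^can) paired with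
y is left. -/
lemma legendre_G {y : Fin 3 → ℝ} (hy : y ∈ openCone) :
    (∑ i, y i * gradG y i) - G y = 1 / 2 * (reebVec ⬝ᵥ y) := by
  have h (v : Fin 3 → ℝ) : v ⬝ᵥ y = v 0 * y 0 + v 1 * y 1 + v 2 * y 2 := by
    simp [dotProduct, Fin.sum_univ_three]
  simp only [gradG_eq hy, gradientG, G, Gcan, GB, Fin.sum_univ_three, Fin.sum_univ_four]
  -- The logarithms cancel formally and can be treated as independent variables.
  generalize Real.log (normal 0 ⬝ᵥ y) = l0
  generalize Real.log (normal 1 ⬝ᵥ y) = l1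
  generalize Real.log (normal 2 ⬝ᵥ y) = l2
  generalize Real.log (normal 3 ⬝ᵥ y) = l3
  generalize Real.log (reebVec ⬝ᵥ y) = lB
  generalize Real.log (canVec ⬝ᵥ y) = lC
  simp only [h]
  ring

lemma hasFDerivAt_radiusCubed (u : Fin 3 → ℝ) :
    HasFDerivAt radiusCubed (dotL
      ![1 / 8 * Real.exp (2 * (u 0 - u 1 - u 2)) * (Real.exp (2 * u 1) + Real.exp (2 * u 2)),
        -(1 / 8) * Real.exp (2 * (u 0 - u 1 - u 2)) * (Real.exp (2 * u 1) + Real.exp (2 * u 2))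
          + 2 * (1 + Real.exp (2 * (u 0 - u 1 - u 2)) / 16) * Real.exp (2 * u 1),
        -(1 / 8) * Real.exp (2 * (u 0 - u 1 - u 2)) * (Real.exp (2 * u 1) + Real.exp (2 * u 2))
          + 2 * (1 + Real.exp (2 * (u 0 - u 1 - u 2)) / 16) * Real.exp (2 * u 2)]) u := by
  have h0 := hasFDerivAt_apply (𝕜 := ℝ) (0 : Fin 3) u
  have h1 := hasFDerivAt_apply (𝕜 := ℝ) (1 : Fin 3) u
  have h2 := hasFDerivAt_apply (𝕜 := ℝ) (2 : Fin 3) u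
  have h := ((((h0.sub h1).sub h2).const_mul 2).exp.mul_const (1 / 16 : ℝ)).const_add 1 |>.mul
    ((h1.const_mul 2).exp.add (h2.const_mul 2).exp)
  have e : radiusCubed = fun u => (1 + Real.exp (2 * (u 0 - u 1 - u 2)) * (1 / 16)) *
      (Real.exp (2 * u 1) + Real.exp (2 * u 2)) := by
    ext u; rw [radiusCubed]; ring
  rw [e]
  refine h.congr_fderiv ?_
  ext w
  simp [dotL_apply, dotProduct, Fin.sum_univ_three]
  ring

lemma pd_kahlerPotential {p : Coord} (hp : p ∈ patch) (i : Fin 3) :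
    pd i kahlerPotential (gradG (momentum p)) = momentum p i := by
  have hr := hp.1
  obtain ⟨⟨a, b⟩, c, d⟩ := patch_half hp
  obtain ⟨e1, e2, e3⟩ := exp_logRadii hp
  have hs := hasFDerivAt_radiusCubed (fun i => gradG (momentum p) i - shift i)
  have hsub : HasFDerivAt (fun x : Fin 3 → ℝ => fun i => x i - shift i)
      (ContinuousLinearMap.id ℝ _) (gradG (momentum p)) := (hasFDerivAt_id _).sub_const shift
  have h := ((hs.comp _ hsub).rpow_const (p := (2 / 3 : ℝ))
    (Or.inl (radiusCubed_pos _).ne')).const_mul (1 / 4 : ℝ)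
  have hpow : (p 0 ^ 3 : ℝ) ^ (2 / 3 - 1 : ℝ) = (p 0)⁻¹ := by
    rw [← Real.rpow_natCast, ← Real.rpow_mul hr.le, ← Real.rpow_neg_one]
    norm_num
  have h1 := Real.sin_sq_add_cos_sq (p 1 / 2)
  have h2 := Real.sin_sq_add_cos_sq (p 2 / 2)
  have k1 := one_add_cos_eq_half (p 1)
  have k2 := one_add_cos_eq_half (p 2)
  unfold pd
  erw [h.fderiv]
  simp only [Function.comp_apply, shifted_gradG_momentum hp, radiusCubed_logRadii hp]
  rw [hpow]
  simp only [smul_apply, ContinuousLinearMap.comp_apply, ContinuousLinearMap.id_apply, dotL_apply,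
    dotProduct_single, mul_one, smul_eq_mul]
  have hg := congrFun (shifted_gradG_momentum hp)
  simp only [hg, e1, e2, e3]
  rw [momentum_eq]
  have c1 : Real.cos (p 1) = 2 * Real.cos (p 1 / 2) ^ 2 - 1 := by linarith
  have c2 : Real.cos (p 2) = 2 * Real.cos (p 2 / 2) ^ 2 - 1 := by linarith
  have s1 : Real.sin (p 1 / 2) ^ 2 = 1 - Real.cos (p 1 / 2) ^ 2 := by linarith
  have s2 : Real.sin (p 2 / 2) ^ 2 = 1 - Real.cos (p 2 / 2) ^ 2 := by linarith
  have s3 : 1 - Real.cos (p 1 / 2) ^ 2 ≠ 0 := by rw [← s1]; positivity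
  rw [c1, c2, s1, s2]
  fin_cases i <;> simp <;> field_simp <;> ring

/-! ### The differentials of the complex coordinates -/

/-- The differentials of the real parts of the complex coordinates. -/
def dlogRadii (p v : Coord) : Fin 3 → ℝ :=
  ![3 / p 0 * v 0 + Real.cos (p 1) / Real.sin (p 1) * v 1
      + Real.cos (p 2) / Real.sin (p 2) * v 2,
    3 / 2 / p 0 * v 0 + (1 + Real.cos (p 1)) / Real.sin (p 1) / 2 * v 1
      - (1 - Real.cos (p 2)) / Real.sin (p 2) / 2 * v 2,
    3 / 2 / p 0 * v 0 + (1 + Real.cos (p 1)) / Real.sin (p 1) / 2 * v 1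
      + (1 + Real.cos (p 2)) / Real.sin (p 2) / 2 * v 2]

lemma dlogRadii_torusField (p : Coord) (j : Fin 3) : dlogRadii p (torusField j) = 0 := by
  ext i
  fin_cases i <;> fin_cases j <;> simp [dlogRadii, torusField]

lemma contDiff_angle (i : Fin 3) : ContDiff ℝ ∞ fun q => angle q i := by
  fin_cases i <;> simp [angle] <;> fun_prop

section patch

variable {p : Coord} (hp : p ∈ patch)
include hp

lemma contDiffAt_logRadii (i : Fin 3) : ContDiffAt ℝ ∞ (fun q => logRadii q i) p := by
  have h0 := hp.1.ne'
  have h1 := (patch_sin_one hp).ne'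
  have h2 := (patch_sin_two hp).ne'
  obtain ⟨⟨a, b⟩, c, d⟩ := patch_half hp
  have l0 : ContDiffAt ℝ ∞ (fun q : Coord => Real.log (q 0)) p :=
    ContDiffAt.log (by fun_prop) h0
  have l1 : ContDiffAt ℝ ∞ (fun q : Coord => Real.log (Real.sin (q 1))) p :=
    ContDiffAt.log (by fun_prop) h1
  have l2 : ContDiffAt ℝ ∞ (fun q : Coord => Real.log (Real.sin (q 2))) p :=
    ContDiffAt.log (by fun_prop) h2
  have m1 : ContDiffAt ℝ ∞ (fun q : Coord => Real.log (Real.sin (q 1 / 2))) p :=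
    ContDiffAt.log (by fun_prop) a.ne'
  have m2 : ContDiffAt ℝ ∞ (fun q : Coord => Real.log (Real.sin (q 2 / 2))) p :=
    ContDiffAt.log (by fun_prop) c.ne'
  have m3 : ContDiffAt ℝ ∞ (fun q : Coord => Real.log (Real.cos (q 2 / 2))) p :=
    ContDiffAt.log (by fun_prop) d.ne'
  fin_cases i
  · exact ((contDiffAt_const.mul l0).add l1).add l2
  · exact ((contDiffAt_const.mul l0).add m1).add m3
  · exact ((contDiffAt_const.mul l0).add m1).add m2

lemma contDiffAt_zc_apply (i : Fin 3) : ContDiffAt ℝ ∞ (fun q => zc q i) p := by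
  simp only [zc_eq]
  exact (Complex.ofRealCLM.contDiff.contDiffAt.comp p (contDiffAt_logRadii hp i)).add
    (contDiffAt_const.mul (Complex.ofRealCLM.contDiff.contDiffAt.comp p
      (contDiff_angle i).contDiffAt))

lemma contDiffAt_zc : ContDiffAt ℝ ∞ zc p :=
  contDiffAt_pi.2 fun i => contDiffAt_zc_apply hp i

lemma fderiv_logRadii (v : Coord) (i : Fin 3) :
    fderiv ℝ (fun q => logRadii q i) p v = dlogRadii p v i := by
  have h0 := hp.1.ne'
  have h1 := (patch_sin_one hp).ne'
  have h2 := (patch_sin_two hp).ne'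
  obtain ⟨⟨a, b⟩, c, d⟩ := patch_half hp
  have l0 := (hasFDerivAt_apply (𝕜 := ℝ) (0 : Fin 6) p).log h0
  have l1 := (hasFDerivAt_apply (𝕜 := ℝ) (1 : Fin 6) p).sin.log h1
  have l2 := (hasFDerivAt_apply (𝕜 := ℝ) (2 : Fin 6) p).sin.log h2
  have m1 := ((hasFDerivAt_apply (𝕜 := ℝ) (1 : Fin 6) p).mul_const (1 / 2 : ℝ)).sin.log
    (by rw [mul_one_div]; exact a.ne')
  have m2 := ((hasFDerivAt_apply (𝕜 := ℝ) (2 : Fin 6) p).mul_const (1 / 2 : ℝ)).sin.log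
    (by rw [mul_one_div]; exact c.ne')
  have m3 := ((hasFDerivAt_apply (𝕜 := ℝ) (2 : Fin 6) p).mul_const (1 / 2 : ℝ)).cos.log
    (by rw [mul_one_div]; exact d.ne')
  simp only [mul_one_div] at m1 m2 m3
  have cot {x : ℝ} (hs : 0 < Real.sin (x / 2)) (hc : 0 < Real.cos (x / 2)) :
      (1 + Real.cos x) / Real.sin x = (Real.sin (x / 2))⁻¹ * Real.cos (x / 2) := by
    rw [one_add_cos_eq_half, sin_eq_half x]; field_simp
  have tan {x : ℝ} (hs : 0 < Real.sin (x / 2)) (hc : 0 < Real.cos (x / 2)) :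
      (1 - Real.cos x) / Real.sin x = (Real.cos (x / 2))⁻¹ * Real.sin (x / 2) := by
    rw [one_sub_cos_eq_half, sin_eq_half x]; field_simp
  fin_cases i
  · erw [(((l0.const_mul 3).add l1).add l2).fderiv]
    simp [dlogRadii]
    ring
  · erw [(((l0.const_mul (3 / 2)).add m1).add m3).fderiv]
    simp [dlogRadii, cot a b, tan c d]
    ring
  · erw [(((l0.const_mul (3 / 2)).add m1).add m2).fderiv]
    simp [dlogRadii, cot a b, cot c d]
    ring

lemma fderiv_zc_apply (v : Coord) (i : Fin 3) :
    fderiv ℝ (fun q => zc q i) p v = (dlogRadii p v i : ℂ) + Complex.I * (angle v i : ℂ) := by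
  have h := (Complex.ofRealCLM.hasFDerivAt.comp p
    ((contDiffAt_logRadii hp i).differentiableAt (by simp)).hasFDerivAt).add
    ((Complex.ofRealCLM.hasFDerivAt.comp p
      ((contDiff_angle i).differentiable (by simp) p).hasFDerivAt).const_mul Complex.I)
  have e : (fun q => zc q i) = fun q => Complex.ofRealCLM (logRadii q i)
      + Complex.I * Complex.ofRealCLM (angle q i) := by
    ext q; simp [zc_eq]
  rw [e]
  erw [h.fderiv]
  simp [fderiv_logRadii hp, fderiv_angle]

lemma fderiv_zc (v : Coord) (i : Fin 3) :
    fderiv ℝ zc p v i = (dlogRadii p v i : ℂ) + Complex.I * (angle v i : ℂ) := by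
  rw [← fderiv_zc_apply hp, fderiv_apply ((contDiffAt_zc hp).differentiableAt (by simp))]
  rfl

/-- With `angle_coneJ`, these are the Cauchy–Riemann equations of z. -/
lemma dlogRadii_coneJ (v : Coord) : dlogRadii p (coneJ p v) = -angle v := by
  have h0 := hp.1.ne'
  have h1 := (patch_sin_one hp).ne'
  have h2 := (patch_sin_two hp).ne'
  ext i
  fin_cases i <;> simp [dlogRadii, coneJ, angle] <;> field_simp <;> ring

lemma angle_coneJ (v : Coord) : angle (coneJ p v) = dlogRadii p v := by
  have h0 := hp.1.ne'
  have h1 := (patch_sin_one hp).ne'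
  have h2 := (patch_sin_two hp).ne'
  ext i
  fin_cases i <;> simp [dlogRadii, coneJ, angle] <;> field_simp <;> ring

lemma fderiv_zc_coneJ (v : Coord) :
    fderiv ℝ zc p (coneJ p v) = Complex.I • fderiv ℝ zc p v := by
  ext i
  rw [Pi.smul_apply, fderiv_zc hp, fderiv_zc hp, dlogRadii_coneJ hp, angle_coneJ hp, smul_eq_mul]
  simp only [Pi.neg_apply, Complex.ofReal_neg]
  linear_combination (-(angle v i : ℂ)) * Complex.I_mul_I

lemma fderiv_zc_torusField (i j : Fin 3) :
    fderiv ℝ zc p (torusField j) i = if i = j then Complex.I else 0 := by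
  rw [fderiv_zc hp, dlogRadii_torusField, angle_torusField]
  split_ifs <;> simp

/-- The frame of `torusField`s spans the tangent space over `ℂ`. -/
lemma fderiv_zc_sum (c : Fin 3 → ℂ) :
    fderiv ℝ zc p (∑ j, ((c j).im • torusField j - (c j).re • coneJ p (torusField j))) = c := by
  ext i
  simp only [map_sum, map_sub, map_smul, fderiv_zc_coneJ hp, Finset.sum_apply, Pi.sub_apply,
    Pi.smul_apply, fderiv_zc_torusField hp]
  have (j : Fin 3) : ((c j).im • (if i = j then Complex.I else 0)
      - (c j).re • Complex.I • (if i = j then Complex.I else 0) : ℂ)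
      = if i = j then c j else 0 := by
    split_ifs
    · apply Complex.ext <;> simp
    · simp
  simp only [this, Finset.sum_ite_eq, Finset.mem_univ, if_true]

lemma fderiv_zc_bijective : Function.Bijective (fderiv ℝ zc p) := by
  have hs : Function.Surjective (fderiv ℝ zc p) := fun c => ⟨_, fderiv_zc_sum hp c⟩
  have hf : Module.finrank ℝ Coord = Module.finrank ℝ (Fin 3 → ℂ) := by
    rw [Module.finrank_pi, Module.finrank_pi_fintype]
    simp [Complex.finrank_real_complex]
  exact ⟨(LinearMap.injective_iff_surjective_of_finrank_eq_finrank
    (f := (fderiv ℝ zc p : Coord →ₗ[ℝ] (Fin 3 → ℂ))) hf).2 hs, hs⟩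

/-- The eⱼ and J eⱼ form a real frame: dzⁱ(eⱼ) = i δ and dzⁱ(J eⱼ) = -δ, which explains the
coefficients. -/
lemma eq_sum_torusField (v : Coord) :
    v = ∑ j, ((fderiv ℝ zc p v j).im • torusField j
      - (fderiv ℝ zc p v j).re • coneJ p (torusField j)) :=
  (fderiv_zc_bijective hp).1 (fderiv_zc_sum hp _).symm

/-! ### The metric in symplectic coordinates -/

/-- The real parts of the complex coordinates are dual to the momentum map via the Hessian. -/
lemma dlogRadii_eq_mulVec (v : Coord) :
    dlogRadii p v = (hessG (momentum p)).mulVec (dmomentum p v) := by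
  have hy := momentum_mem_openCone hp
  ext i
  have h := (hasFDerivAt_gradientG hy i).comp p (differentiable_momentum p).hasFDerivAt
  -- `gradG_momentum` holds on the open patch, so it may be differentiated there.
  have e : (fun q => logRadii q i) =ᶠ[nhds p]
      fun q => ((fun y => gradientG y i) ∘ momentum) q - shift i := by
    filter_upwards [patch_isOpen.mem_nhds hp] with q hq
    rw [Function.comp_apply, ← gradG_eq (momentum_mem_openCone hq), gradG_momentum hq,
      add_sub_cancel_right]
  rw [← fderiv_logRadii hp, e.fderiv_eq, (h.sub_const (shift i)).fderiv,
    ContinuousLinearMap.comp_apply, dotL_apply, Matrix.mulVec]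
  have hm : fderiv ℝ momentum p v = dmomentum p v := by
    ext j
    rw [← fderiv_momentum, fderiv_apply (differentiable_momentum p)]
    rfl
  rw [hm]
  congr 1
  ext j
  exact (hessG_apply hy i j).symm

/-- Compose d(Re z) = H dy with J, use d(Re z)∘J = -dΦ, and invert H. -/
lemma dmomentum_coneJ (v : Coord) :
    dmomentum p (coneJ p v) = -((hessG (momentum p))⁻¹.mulVec (angle v)) := by
  have hu := (hessG_posDef (momentum_mem_openCone hp)).isUnit
  rw [Matrix.isUnit_iff_isUnit_det] at hu
  have h := dlogRadii_eq_mulVec hp (coneJ p v)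
  rw [dlogRadii_coneJ hp] at h
  rw [← Matrix.mulVec_neg, h, Matrix.mulVec_mulVec, Matrix.nonsing_inv_mul _ hu,
    Matrix.one_mulVec]

lemma coneMetric_eq (v w : Coord) :
    coneMetric p v w
      = (∑ i, ∑ j, hessG (momentum p) i j * dmomentum p v i * dmomentum p w j)
        + ∑ i, ∑ j, (hessG (momentum p))⁻¹ i j * angle v i * angle w j := by
  have hP := hessG_posDef (momentum_mem_openCone hp)
  have hs := hP.isHermitian.apply
  have hi := hP.inv.isHermitian.apply
  simp only [star_trivial] at hs hi
  have h : coneMetric p v w = - kahlerForm p ![coneJ p v, w] := by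
    rw [kahlerForm_eq_coneMetric hp, coneJ_coneJ hp]
    simp [coneMetric, metricT11]
    ring
  rw [h, kahlerForm_darboux, angle_coneJ hp, dmomentum_coneJ hp, dlogRadii_eq_mulVec hp]
  simp only [Matrix.mulVec, dotProduct, Pi.neg_apply, Fin.sum_univ_three]
  rw [hs 0 1, hs 0 2, hs 1 2, hi 0 1, hi 0 2, hi 1 2]
  ring

end patch

/-! ### Wedge products of covectors -/

section wedge

variable {A : Type} [CommRing A] [Algebra ℝ A]

/-- The wedge product of a family of covectors. -/
def detForm {n : ℕ} (α : Fin n → Coord →ₗ[ℝ] A) : Coord [⋀^Fin n]→ₗ[ℝ] A :=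
  MultilinearMap.alternatization ((MultilinearMap.mkPiAlgebra ℝ (Fin n) A).compLinearMap α)

lemma detForm_apply {n : ℕ} (α : Fin n → Coord →ₗ[ℝ] A) (v : Fin n → Coord) :
    detForm α v = (Matrix.of fun j i => α i (v j)).det := by
  rw [detForm, MultilinearMap.alternatization_apply, Matrix.det_apply]
  simp

/-- Summing over shuffles turns two alternatizations into the alternatization of the product, with
no factorials. -/
lemma wedge_detForm {m n : ℕ} (α : Fin m → Coord →ₗ[ℝ] A) (β : Fin n → Coord →ₗ[ℝ] A) :
    wedge (detForm α) (detForm β) = detForm (Fin.append α β) := by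
  ext v
  rw [wedge, detForm, detForm, ← MultilinearMap.domCoprod_alternization,
    ← LinearMap.compMultilinearMap_alternatization, AlternatingMap.domDomCongr_apply,
    MultilinearMap.alternatization_apply, detForm, MultilinearMap.alternatization_apply,
    ← Equiv.sum_comp (Equiv.permCongr finSumFinEquiv)]
  refine Finset.sum_congr rfl fun σ _ => ?_
  rw [Equiv.Perm.sign_permCongr]
  simp [Fin.prod_univ_add, MultilinearMap.domCoprod_apply]

lemma wedge_add_left {m n : ℕ} (α α' : Coord [⋀^Fin m]→ₗ[ℝ] A) (β : Coord [⋀^Fin n]→ₗ[ℝ] A) :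
    wedge (α + α') β = wedge α β + wedge α' β := by
  ext v
  simp only [wedge, ← AlternatingMap.domCoprod'_apply, TensorProduct.add_tmul, map_add]
  simp

lemma wedge_add_right {m n : ℕ} (α : Coord [⋀^Fin m]→ₗ[ℝ] A) (β β' : Coord [⋀^Fin n]→ₗ[ℝ] A) :
    wedge α (β + β') = wedge α β + wedge α β' := by
  ext v
  simp only [wedge, ← AlternatingMap.domCoprod'_apply, TensorProduct.tmul_add, map_add]
  simp

lemma wedge_smul_smul {m n : ℕ} (c d : A) (α : Coord [⋀^Fin m]→ₗ[ℝ] A)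
    (β : Coord [⋀^Fin n]→ₗ[ℝ] A) : wedge (c • α) (d • β) = (c * d) • wedge α β := by
  ext v
  simp only [wedge, AlternatingMap.domDomCongr_apply, LinearMap.compAlternatingMap_apply,
    AlternatingMap.domCoprod_apply, AlternatingMap.smul_apply, smul_eq_mul, map_sum,
    Finset.mul_sum, sum_apply]
  refine Finset.sum_congr rfl fun σ _ => ?_
  induction σ using Quotient.inductionOn' with
  | h σ =>
    simp only [AlternatingMap.domCoprod.summand_mk'']
    simp only [_root_.smul_apply, MultilinearMap.domDomCongr_apply,
      MultilinearMap.domCoprod_apply]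
    simp
    simp only [Units.smul_def, zsmul_eq_mul]
    ring

/-- The wedge product of two triples of covectors, as a determinant over `Fin 3 ⊕ Fin 3`. -/
lemma detForm_append_apply (α β : Fin 3 → Coord →ₗ[ℝ] A) (v : Fin (3 + 3) → Coord) :
    detForm (Fin.append α β) v
      = (Matrix.of fun j i : Fin 3 ⊕ Fin 3 => Sum.elim α β i (v (finSumFinEquiv j))).det := by
  rw [detForm_apply, ← Matrix.det_submatrix_equiv_self finSumFinEquiv]
  congr 1
  ext j i
  rcases i with i | i
  · change Fin.append α β (Fin.castAdd 3 i) _ = _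
    rw [Fin.append_left]
    rfl
  · change Fin.append α β (Fin.natAdd 3 i) _ = _
    rw [Fin.append_right]
    rfl

lemma detForm_comp_perm {n : ℕ} (α : Fin n → Coord →ₗ[ℝ] A) (σ : Equiv.Perm (Fin n)) :
    detForm (α ∘ σ) = (Equiv.Perm.sign σ : ℤ) • detForm α := by
  ext v
  rw [detForm_apply, AlternatingMap.smul_apply, detForm_apply, zsmul_eq_mul]
  exact Matrix.det_permute' σ (Matrix.of fun j i => α i (v j))

lemma detForm_eq_zero {n : ℕ} (α : Fin n → Coord →ₗ[ℝ] A) {i j : Fin n} (hij : i ≠ j)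
    (h : α i = α j) : detForm α = 0 := by
  ext v
  rw [detForm_apply, AlternatingMap.zero_apply]
  exact Matrix.det_zero_of_column_eq hij fun k => by simp [h]

/-- The cube of a two-form in Darboux coordinates. -/
lemma wedge_cube_darboux (y φ : Fin 3 → Coord →ₗ[ℝ] A) (κ : Coord [⋀^Fin 2]→ₗ[ℝ] A)
    (hκ : κ = ∑ i, detForm ![y i, φ i]) :
    wedge (wedge κ κ) κ = -(6 : ℤ) • detForm (Fin.append y φ) := by
  set h : Fin 3 → Fin 3 → Fin 3 → Coord [⋀^Fin 6]→ₗ[ℝ] A := fun i j k =>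
    detForm ![y i, φ i, y j, φ j, y k, φ k] with hh
  have e (i j k : Fin 3) :
      wedge (wedge (detForm ![y i, φ i]) (detForm ![y j, φ j])) (detForm ![y k, φ k])
        = h i j k := by
    rw [wedge_detForm, wedge_detForm]
    simp only [hh]
    congr 1
    ext a
    fin_cases a <;> rfl
  -- Of the 27 terms of the cube only the six with distinct indices survive, and they agree because
  -- two-forms commute.
  have z1 (i k : Fin 3) : h i i k = 0 := detForm_eq_zero _ (i := 0) (j := 2) (by decide) rfl
  have z2 (i k : Fin 3) : h k i i = 0 := detForm_eq_zero _ (i := 2) (j := 4) (by decide) rfl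
  have z3 (i k : Fin 3) : h i k i = 0 := detForm_eq_zero _ (i := 0) (j := 4) (by decide) rfl
  have s1 (i j k : Fin 3) : h i j k = h j i k := by
    have := detForm_comp_perm ![y j, φ j, y i, φ i, y k, φ k]
      (Equiv.swap 0 2 * Equiv.swap 1 3)
    rw [show Equiv.Perm.sign (Equiv.swap (0 : Fin 6) 2 * Equiv.swap 1 3) = 1 by decide] at this
    simp only [Units.val_one, one_smul] at this
    exact (congrArg detForm (funext fun a => by fin_cases a <;> rfl)).trans this
  have s2 (i j k : Fin 3) : h i j k = h i k j := by
    have := detForm_comp_perm ![y i, φ i, y k, φ k, y j, φ j]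
      (Equiv.swap 2 4 * Equiv.swap 3 5)
    rw [show Equiv.Perm.sign (Equiv.swap (2 : Fin 6) 4 * Equiv.swap 3 5) = 1 by decide] at this
    simp only [Units.val_one, one_smul] at this
    exact (congrArg detForm (funext fun a => by fin_cases a <;> rfl)).trans this
  -- Collecting the y's before the φ's takes three transpositions, hence the sign.
  have hA : h 0 1 2 = -detForm (Fin.append y φ) := by
    have := detForm_comp_perm (n := 6) (Fin.append y φ)
      (Equiv.swap 1 3 * Equiv.swap 4 2 * Equiv.swap 2 3)
    rw [show Equiv.Perm.sign (Equiv.swap (1 : Fin 6) 3 * Equiv.swap 4 2 * Equiv.swap 2 3) = -1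
      by decide] at this
    simp only [Units.val_neg, Units.val_one, neg_smul, one_smul] at this
    rw [hh, ← this]
    congr 1
  subst hκ
  simp only [Fin.sum_univ_three, wedge_add_left, wedge_add_right, e, z1, z2, z3]
  rw [s2 0 2 1, s1 1 0 2, s1 2 0 1, s2 0 2 1, s2 1 2 0, s1 1 0 2, s2 2 1 0, s1 2 0 1, s2 0 2 1, hA]
  module

end wedge

/-! ### The volume form -/

/-- The differential of the momentum map, as linear forms. -/
def momentumForm (p : Coord) (i : Fin 3) : Coord →ₗ[ℝ] ℝ :=
  (fderiv ℝ (fun q => momentum q i) p : Coord →ₗ[ℝ] ℝ)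

/-- The differentials of the angles, as linear forms. -/
def angleForm (i : Fin 3) : Coord →ₗ[ℝ] ℝ :=
  (fderiv ℝ (fun q => angle q i) 0 : Coord →ₗ[ℝ] ℝ)

lemma momentumForm_apply (p v : Coord) (i : Fin 3) : momentumForm p i v = dmomentum p v i :=
  fderiv_momentum p v i

lemma angleForm_apply (v : Coord) (i : Fin 3) : angleForm i v = angle v i :=
  fderiv_angle 0 v i

lemma kahlerForm_eq_sum (p : Coord) :
    (kahlerForm p).toAlternatingMap = ∑ i, detForm ![momentumForm p i, angleForm i] := by
  ext v
  have hv : v = ![v 0, v 1] := by ext i; fin_cases i <;> rfl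
  generalize v 0 = a at hv
  generalize v 1 = b at hv
  subst hv
  rw [ContinuousAlternatingMap.coe_toAlternatingMap, kahlerForm_darboux, Fin.sum_univ_three,
    Fin.sum_univ_three, AlternatingMap.add_apply, AlternatingMap.add_apply]
  simp only [detForm_apply, Matrix.det_fin_two]
  simp [momentumForm_apply, angleForm_apply]
  ring

lemma coneVol_eq (p : Coord) (v : Fin 6 → Coord) :
    coneVol p v = -detForm (Fin.append (momentumForm p) angleForm) v := by
  rw [coneVol, wedge_cube_darboux _ _ _ (kahlerForm_eq_sum p)]
  simp [Nat.factorial]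

/-- The differentials of the complex coordinates, as linear forms. -/
def zForm (p : Coord) (i : Fin 3) : Coord →ₗ[ℝ] ℂ :=
  (fderiv ℝ (fun q => zc q i) p : Coord →ₗ[ℝ] ℂ)

/-- Complex conjugation of linear forms. -/
def conjLin (α : Coord →ₗ[ℝ] ℂ) : Coord →ₗ[ℝ] ℂ := Complex.conjAe.toLinearMap.comp α

lemma wedge3_eq (p : Coord) :
    (wedge3 fun i => fderiv ℝ (fun q => zc q i) p).toAlternatingMap = detForm (zForm p) := by
  rw [wedge3, ContinuousMultilinearMap.alternatization_apply_toAlternatingMap]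
  rfl

lemma wedge3_apply (α : Fin 3 → (Coord →L[ℝ] ℂ)) (v : Fin 3 → Coord) :
    wedge3 α v = (Matrix.of fun j i => α i (v j)).det :=
  detForm_apply (fun i => (α i : Coord →ₗ[ℝ] ℂ)) v ▸ (by
    rw [wedge3, ← ContinuousAlternatingMap.coe_toAlternatingMap,
      ContinuousMultilinearMap.alternatization_apply_toAlternatingMap]
    rfl)

lemma conjForm_toAlternatingMap (c : ℂ) (α : Fin 3 → Coord →ₗ[ℝ] ℂ)
    (W : Coord [⋀^Fin 3]→L[ℝ] ℂ) (hW : W.toAlternatingMap = c • detForm α) :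
    (conjForm W).toAlternatingMap
      = (starRingEnd ℂ c) • detForm fun i => conjLin (α i) := by
  ext v
  have : W v = c * detForm α v := by
    rw [← ContinuousAlternatingMap.coe_toAlternatingMap, hW]; rfl
  change starRingEnd ℂ (W v) = starRingEnd ℂ c * _
  rw [this, map_mul, detForm_apply, RingHom.map_det]
  exact congrArg _ (detForm_apply (fun i => conjLin (α i)) v).symm

/-- The change of frame from the complex coordinates to the symplectic ones. -/
lemma detForm_zForm {p : Coord} (hp : p ∈ patch) (v : Fin 6 → Coord) :
    detForm (Fin.append (zForm p) fun i => conjLin (zForm p i)) v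
      = 8 * Complex.I * (((hessG (momentum p)).det *
        detForm (Fin.append (momentumForm p) angleForm) v : ℝ) : ℂ) := by
  set H : Matrix (Fin 3) (Fin 3) ℂ := (hessG (momentum p)).map (fun x : ℝ => (x : ℂ)) with hH
  set M : Matrix (Fin 3 ⊕ Fin 3) (Fin 3 ⊕ Fin 3) ℝ := Matrix.of fun j i =>
    Sum.elim (momentumForm p) angleForm i (v (finSumFinEquiv j)) with hM
  have hz (w : Coord) (i : Fin 3) : zForm p i w
      = (∑ j, (dmomentum p w j : ℂ) * H i j) + Complex.I * (angle w i : ℂ) := by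
    refine (fderiv_zc_apply hp w i).trans ?_
    rw [dlogRadii_eq_mulVec hp]
    simp [Matrix.mulVec, dotProduct, hH, mul_comm]
  -- dz = H dy + i dΦ and dz̄ = H dy - i dΦ. The constant block factor has determinant (-2i)³ = 8i.
  have key : (Matrix.of fun j i : Fin 3 ⊕ Fin 3 =>
      Sum.elim (zForm p) (fun i => conjLin (zForm p i)) i (v (finSumFinEquiv j)))
      = M.map (fun x : ℝ => (x : ℂ)) * (Matrix.fromBlocks H.transpose 0 0 1 *
        Matrix.fromBlocks 1 1 (Complex.I • 1) (-Complex.I • 1)) := by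
    ext j i
    rw [Matrix.fromBlocks_multiply, Matrix.mul_apply, Fintype.sum_sum_type]
    rcases i with i | i
    · simp [hM, hz, momentumForm_apply, angleForm_apply, Matrix.one_apply, mul_comm]
    · simp [hM, conjLin, hz, momentumForm_apply, angleForm_apply, Matrix.one_apply, hH, mul_comm]
  have hdH : H.det = ((hessG (momentum p)).det : ℂ) :=
    (RingHom.map_det Complex.ofRealHom _).symm
  have hdM : (M.map (fun x : ℝ => (x : ℂ))).det = (M.det : ℂ) :=
    (RingHom.map_det Complex.ofRealHom _).symm
  have h8 : ((-Complex.I • 1 : Matrix (Fin 3) (Fin 3) ℂ) - Complex.I • 1).det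
      = 8 * Complex.I := by
    rw [← sub_smul, Matrix.det_smul]
    simp
    linear_combination (-8 * Complex.I) * Complex.I_mul_I
  have e1 := detForm_append_apply (zForm p) (fun i => conjLin (zForm p i)) v
  have e2 := detForm_append_apply (momentumForm p) angleForm v
  rw [e1, e2, key, Matrix.det_mul, Matrix.det_mul, Matrix.det_fromBlocks_zero₂₁,
    Matrix.det_fromBlocks_one₁₁, Matrix.mul_one, h8, Matrix.det_transpose, hdH, hdM]
  simp
  ring

/-- Re z¹ = x¹ - k₁ with e^{-2k₁} = 2¹¹e⁻³, which cancels all but 81 in the Monge–Ampère constant.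
-/
lemma norm_exp_zc {p : Coord} (hp : p ∈ patch) :
    ‖Complex.exp (zc p 0)‖ ^ 2 * (hessG (momentum p)).det = 81 := by
  have hg := gradG_momentum hp 0
  rw [monge_ampere (momentum_mem_openCone hp), Complex.norm_exp, (zc_re_im p 0).1, hg,
    ← Real.exp_nat_mul]
  have h2 : Real.exp (11 * Real.log 2) = 2 ^ 11 := by
    rw [show 11 * Real.log 2 = (11 : ℕ) * Real.log 2 by norm_num, Real.exp_nat_mul,
      Real.exp_log two_pos]
  have h3 : 11 * Real.log 2
      = ((2 : ℕ) : ℝ) * logRadii p 0 + 3 + -2 * (logRadii p 0 + shift 0) := by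
    simp [shift]; ring
  rw [h3, Real.exp_add, Real.exp_add] at h2
  linear_combination 81 / 2 ^ 11 * h2

/-- A pointwise statement, so c may vary with p; this is how the normalization controls |f| in W =
fΩ. -/
lemma wedge_conj {p : Coord} (hp : p ∈ patch) (W : Coord [⋀^Fin 3]→L[ℝ] ℂ) (c : ℂ)
    (hW : W = c • Omega p) (v : Fin 6 → Coord) :
    Complex.I ^ 3 / 2 ^ 3 * (-1) ^ 3 *
      wedge W.toAlternatingMap (conjForm W).toAlternatingMap v
      = ((81 * ‖c‖ ^ 2 * coneVol p v : ℝ) : ℂ) := by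
  have h : W.toAlternatingMap = (c * Complex.exp (zc p 0)) • detForm (zForm p) := by
    rw [hW, Omega, ← wedge3_eq, mul_smul]
    rfl
  rw [conjForm_toAlternatingMap _ _ _ h, h, wedge_smul_smul, wedge_detForm,
    AlternatingMap.smul_apply, detForm_zForm hp, coneVol_eq, ← norm_exp_zc hp, Complex.mul_conj,
    Complex.normSq_eq_norm_sq, norm_mul, smul_eq_mul]
  push_cast
  have := Complex.I_sq
  linear_combination (Complex.I ^ 2 - 1) * (-1) * (‖c‖ ^ 2 : ℂ) * (‖Complex.exp (zc p 0)‖ ^ 2 : ℂ)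
    * ((hessG (momentum p)).det : ℂ)
    * (detForm (Fin.append (momentumForm p) angleForm) v : ℂ) * this

/-! ### The form `Ω` -/

lemma alternating_zero_apply {n : ℕ} (v : Fin n → Coord) :
    (0 : Coord [⋀^Fin n]→L[ℝ] ℂ) v = 0 := rfl

lemma removeNth_four {X : Type*} (a b c d : X) :
    Fin.removeNth (α := fun _ : Fin 4 => X) 0 ![a, b, c, d] = ![b, c, d] ∧
    Fin.removeNth (α := fun _ : Fin 4 => X) 1 ![a, b, c, d] = ![a, c, d] ∧
    Fin.removeNth (α := fun _ : Fin 4 => X) 2 ![a, b, c, d] = ![a, b, d] ∧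
    Fin.removeNth (α := fun _ : Fin 4 => X) 3 ![a, b, c, d] = ![a, b, c] := by
  refine ⟨?_, ?_, ?_, ?_⟩ <;> (ext1 i; fin_cases i <;> rfl)


lemma Omega_apply (p : Coord) (v : Fin 3 → Coord) :
    Omega p v = Complex.exp (zc p 0)
      * (Matrix.of fun j i => fderiv ℝ (fun q => zc q i) p (v j)).det := by
  rw [Omega, ContinuousAlternatingMap.smul_apply, wedge3_apply, smul_eq_mul]

/-- The form `e^{w¹} dw¹ ∧ dw² ∧ dw³` on `ℂ³`. -/
def expForm (w : Fin 3 → ℂ) : (Fin 3 → ℂ) [⋀^Fin 3]→L[ℝ] ℂ :=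
  Complex.exp (w 0) • ContinuousMultilinearMap.alternatization
    ((ContinuousMultilinearMap.mkPiAlgebra ℝ (Fin 3) ℂ).compContinuousLinearMap fun i =>
      ContinuousLinearMap.proj (R := ℝ) (φ := fun _ : Fin 3 => ℂ) i)

lemma expForm_apply (w : Fin 3 → ℂ) (u : Fin 3 → Fin 3 → ℂ) :
    expForm w u = Complex.exp (w 0) * (Matrix.of fun j i => u j i).det := by
  rw [expForm, ContinuousAlternatingMap.smul_apply,
    ContinuousMultilinearMap.alternatization_apply_apply, Matrix.det_apply, smul_eq_mul]
  simp

lemma differentiable_expForm : Differentiable ℝ expForm := by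
  have : Differentiable ℝ fun w : Fin 3 → ℂ => Complex.exp (w 0) := by fun_prop
  exact this.smul_const _

/-- The derivative of the coefficient is a multiple of dw¹, already a factor. Closedness of Ω
follows by pullback along z. -/
lemma extDeriv_expForm (w : Fin 3 → ℂ) : extDeriv expForm w = 0 := by
  ext u
  rw [extDeriv_apply (differentiable_expForm w)]
  have hd (c : ℂ) (v : Fin 3 → ℂ) : fderiv ℝ (fun w : Fin 3 → ℂ => Complex.exp (w 0) * c) w v
      = Complex.exp (w 0) * v 0 * c := by
    have h := ((hasFDerivAt_apply (𝕜 := ℝ) (0 : Fin 3) w).cexp.mul_const c).fderiv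
    rw [h]
    simp
    ring
  simp only [expForm_apply, hd, Matrix.det_fin_three, Matrix.of_apply]
  rw [Fin.sum_univ_four]
  have r00 : Fin.removeNth 0 u 0 = u 1 := rfl
  have r01 : Fin.removeNth 0 u 1 = u 2 := rfl
  have r02 : Fin.removeNth 0 u 2 = u 3 := rfl
  have r10 : Fin.removeNth 1 u 0 = u 0 := rfl
  have r11 : Fin.removeNth 1 u 1 = u 2 := rfl
  have r12 : Fin.removeNth 1 u 2 = u 3 := rfl
  have r20 : Fin.removeNth 2 u 0 = u 0 := rfl
  have r21 : Fin.removeNth 2 u 1 = u 1 := rfl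
  have r22 : Fin.removeNth 2 u 2 = u 3 := rfl
  have r30 : Fin.removeNth 3 u 0 = u 0 := rfl
  have r31 : Fin.removeNth 3 u 1 = u 1 := rfl
  have r32 : Fin.removeNth 3 u 2 = u 2 := rfl
  simp only [r00, r01, r02, r10, r11, r12, r20, r21, r22, r30, r31, r32]
  norm_num
  ring

/-- A map into alternating forms is smooth when its values on fixed vectors are. -/
lemma contDiffAt_alternating_of_apply {E : Type*} [NormedAddCommGroup E] [NormedSpace ℝ E]
    {n : ℕ} {f : E → Coord [⋀^Fin n]→L[ℝ] ℂ} {x : E}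
    (h : ∀ v, ContDiffAt ℝ ∞ (fun y => f y v) x) : ContDiffAt ℝ ∞ f x := by
  let b := Pi.basisFun ℝ (Fin 6)
  let L : (Coord [⋀^Fin n]→L[ℝ] ℂ) →ₗ[ℝ] ((Fin n → Fin 6) → ℂ) :=
    { toFun := fun W s => W fun i => b (s i)
      map_add' := fun _ _ => rfl
      map_smul' := fun _ _ => rfl }
  have hL : Function.Injective L := fun W W' hW =>
    ContinuousAlternatingMap.toAlternatingMap_injective
      (b.ext_alternating fun s _ => congrFun hW s)
  -- A form is recovered linearly from its values on basis tuples, and linear maps in finite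
  -- dimension are smooth.
  obtain ⟨g, hg⟩ := LinearMap.exists_leftInverse_of_injective L (LinearMap.ker_eq_bot.2 hL)
  have e : f = fun y => LinearMap.toContinuousLinearMap g (L (f y)) := by
    ext1 y
    exact (LinearMap.congr_fun hg (f y)).symm
  rw [e]
  exact (LinearMap.toContinuousLinearMap g).contDiff.contDiffAt.comp x
    (contDiffAt_pi.2 fun s => h _)

section patch

variable {p : Coord} (hp : p ∈ patch)
include hp

lemma fderiv_zc_eq (v : Coord) (i : Fin 3) :
    fderiv ℝ (fun q => zc q i) p v = fderiv ℝ zc p v i := by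
  rw [fderiv_zc hp, fderiv_zc_apply hp]

lemma Omega_eq_pullback :
    Omega p = (expForm (zc p)).compContinuousLinearMap (fderiv ℝ zc p) := by
  ext v
  rw [Omega_apply, ContinuousAlternatingMap.compContinuousLinearMap_apply, expForm_apply]
  simp only [fderiv_zc_eq hp, Function.comp_apply]

lemma contDiffAt_Omega : ContDiffAt ℝ ∞ Omega p := by
  refine contDiffAt_alternating_of_apply fun v => ?_
  have hd (i : Fin 3) (w : Coord) :
      ContDiffAt ℝ ∞ (fun q => fderiv ℝ (fun q => zc q i) q w) p :=
    ((contDiffAt_zc_apply hp i).fderiv_right (m := ∞) (by simp)).clm_apply contDiffAt_const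
  have he : ContDiffAt ℝ ∞ (fun q => Complex.exp (zc q 0)) p := (contDiffAt_zc_apply hp 0).cexp
  simp only [Omega_apply, Matrix.det_fin_three, Matrix.of_apply]
  refine he.mul ?_
  exact ((((((((hd _ _).mul (hd _ _)).mul (hd _ _)).sub (((hd _ _).mul (hd _ _)).mul (hd _ _))).sub
    (((hd _ _).mul (hd _ _)).mul (hd _ _))).add (((hd _ _).mul (hd _ _)).mul (hd _ _))).add
    (((hd _ _).mul (hd _ _)).mul (hd _ _))).sub (((hd _ _).mul (hd _ _)).mul (hd _ _)))

lemma extDeriv_Omega : extDeriv Omega p = 0 := by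
  have e : Omega =ᶠ[nhds p] fun q =>
      (expForm (zc q)).compContinuousLinearMap (fderiv ℝ zc q) := by
    filter_upwards [patch_isOpen.mem_nhds hp] with q hq using Omega_eq_pullback hq
  rw [e.extDeriv_eq, extDeriv_pullback (r := ∞) (differentiable_expForm _) (contDiffAt_zc hp)
    (by
      rw [minSmoothness_of_isRCLikeNormedField]
      exact WithTop.coe_le_coe.2 (le_top : (2 : ℕ∞) ≤ ⊤)), extDeriv_expForm]
  rfl

/-- Since dΩ = 0, only df ∧ Ω remains in the Leibniz rule. -/
lemma extDeriv_smul_Omega {f : Coord → ℂ} (hf : DifferentiableAt ℝ f p) (v : Fin 4 → Coord) :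
    extDeriv (fun q => f q • Omega q) p v
      = ∑ i, (-1) ^ i.val • (fderiv ℝ f p (v i) * Omega p (i.removeNth v)) := by
  have hO : DifferentiableAt ℝ Omega p := (contDiffAt_Omega hp).differentiableAt (by simp)
  have h0 : extDeriv Omega p v = 0 := by rw [extDeriv_Omega hp]; rfl
  rw [extDeriv_apply hO] at h0
  have hs : DifferentiableAt ℝ (fun q => f q • Omega q) p := hf.smul hO
  rw [extDeriv_apply hs]
  have hd (u : Fin 3 → Coord) (w : Coord) :
      fderiv ℝ (fun q => (f q • Omega q) u) p w
        = f p * fderiv ℝ (fun q => Omega q u) p w + fderiv ℝ f p w * Omega p u := by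
    have h := hf.hasFDerivAt.mul (hO.continuousAlternatingMap_apply_const u).hasFDerivAt
    have := h.fderiv
    simp only [ContinuousAlternatingMap.smul_apply, smul_eq_mul]
    erw [this]
    simp [mul_comm]
  simp only [hd, smul_add, Finset.sum_add_distrib]
  have : ∑ i : Fin 4, (-1) ^ i.val • (f p * fderiv ℝ (fun q => Omega q (i.removeNth v)) p (v i))
      = 0 := by
    rw [← mul_zero (f p), ← h0, Finset.mul_sum]
    refine Finset.sum_congr rfl fun i _ => ?_
    rw [mul_smul_comm]
  rw [this, zero_add]

lemma Omega_type (v : Fin 3 → Coord) (j : Fin 3) :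
    Omega p (Function.update v j (coneJ p (v j))) = Complex.I * Omega p v := by
  have : (Matrix.of fun k i => fderiv ℝ (fun q => zc q i) p
        (Function.update v j (coneJ p (v j)) k))
      = (Matrix.of fun k i => fderiv ℝ (fun q => zc q i) p (v k)).updateRow j
        (Complex.I • fun i => fderiv ℝ (fun q => zc q i) p (v j)) := by
    ext k i
    rcases eq_or_ne k j with rfl | hk
    · simp [fderiv_zc_eq hp, fderiv_zc_coneJ hp]
    · simp [hk]
  rw [Omega_apply, Omega_apply, this, Matrix.det_updateRow_smul]
  have : (Matrix.of fun k i => fderiv ℝ (fun q => zc q i) p (v k)).updateRow j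
      (fun i => fderiv ℝ (fun q => zc q i) p (v j))
      = Matrix.of fun k i => fderiv ℝ (fun q => zc q i) p (v k) :=
    Matrix.updateRow_eq_self _ j
  rw [this]
  ring

lemma zc_frame (i j : Fin 3) :
    fderiv ℝ (fun q => zc q i) p (torusField j) = (if i = j then Complex.I else 0) ∧
    fderiv ℝ (fun q => zc q i) p (coneJ p (torusField j)) = if i = j then -1 else 0 := by
  rw [fderiv_zc_eq hp, fderiv_zc_eq hp, fderiv_zc_coneJ hp, Pi.smul_apply,
    fderiv_zc_torusField hp]
  split_ifs <;> simp

lemma Omega_torusField : Omega p torusField = -Complex.I * Complex.exp (zc p 0) := by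
  rw [Omega_apply, Matrix.det_fin_three]
  simp only [Matrix.of_apply, (zc_frame hp _ _).1]
  simp
  ring

/-- A form of type `(3,0)` is determined by its value on the torus generators. -/
lemma eq_zero_of_type {W : Coord [⋀^Fin 3]→L[ℝ] ℂ}
    (hW : ∀ (v : Fin 3 → Coord) (j : Fin 3),
      W (Function.update v j (coneJ p (v j))) = Complex.I * W v)
    (h0 : W torusField = 0) : W = 0 := by
  -- One slot at a time, expand in the eₖ and J eₖ; type (3,0) trades J for a factor i, so testing
  -- on the eₖ is enough.
  have step (j : Fin 3) (v : Fin 3 → Coord)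
      (h : ∀ k, W (Function.update v j (torusField k)) = 0) : W v = 0 := by
    have hJ (k : Fin 3) : W (Function.update v j (coneJ p (torusField k))) = 0 := by
      have := hW (Function.update v j (torusField k)) j
      rwa [Function.update_self, Function.update_idem, h k, mul_zero] at this
    have e := eq_sum_torusField hp (v j)
    rw [← Function.update_eq_self j v, e]
    refine (W.toMultilinearMap.map_update_sum Finset.univ j _ v).trans ?_
    refine Finset.sum_eq_zero fun k _ => ?_
    change W _ = 0
    rw [W.map_update_sub, W.map_update_smul, W.map_update_smul, h, hJ]
    simp
  have base (s : Fin 3 → Fin 3) : W (fun i => torusField (s i)) = 0 := by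
    by_cases hs : Function.Injective s
    · have := W.toAlternatingMap.map_perm torusField
        (Equiv.ofBijective s (Finite.injective_iff_bijective.1 hs))
      refine this.trans ?_
      change _ • W torusField = 0
      rw [h0, smul_zero]
    · exact W.map_eq_zero_of_not_injective _ fun h => hs (Function.Injective.of_comp h)
  ext v
  change W v = 0
  refine step 0 v fun a => step 1 _ fun b => step 2 _ fun c => ?_
  convert base ![a, b, c] using 2
  ext1 i
  fin_cases i <;> simp

/-- On the frame (J eⱼ, eⱼ) the forms (dy, dΦ) have the block diagonal matrix (-H⁻¹, 1).
Nonvanishing lets the volume be cancelled from the normalization. -/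
lemma exists_coneVol_ne_zero : ∃ v, coneVol p v ≠ 0 := by
  have hP := hessG_posDef (momentum_mem_openCone hp)
  refine ⟨fun k : Fin (3 + 3) => Sum.elim (fun j => coneJ p (torusField j)) torusField
    (finSumFinEquiv.symm k), ?_⟩
  have hT (j : Fin 3) : dmomentum p (torusField j) = 0 := by
    ext i
    fin_cases i <;> fin_cases j <;> simp [dmomentum, torusField]
  have hM : (Matrix.of fun j i : Fin 3 ⊕ Fin 3 => Sum.elim (momentumForm p) angleForm i
      ((fun k : Fin (3 + 3) => Sum.elim (fun j => coneJ p (torusField j)) torusField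
    (finSumFinEquiv.symm k))
        (finSumFinEquiv j)))
      = Matrix.fromBlocks (-(hessG (momentum p))⁻¹.transpose) 0 0 1 := by
    ext j i
    rcases j with j | j <;> rcases i with i | i
    · have : angle (torusField j) = Pi.single j 1 := by
        ext k
        rw [angle_torusField, Pi.single_apply]
      simp [momentumForm_apply, dmomentum_coneJ hp, this]
    · simp [angleForm_apply, angle_coneJ hp, dlogRadii_torusField]
    · simp [momentumForm_apply, hT]
    · simp [angleForm_apply, angle_torusField, Matrix.one_apply, eq_comm]
  have e := detForm_append_apply (momentumForm p) angleForm
    (fun k : Fin (3 + 3) => Sum.elim (fun j => coneJ p (torusField j)) torusField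
    (finSumFinEquiv.symm k))
  rw [coneVol_eq]
  rw [hM, Matrix.det_fromBlocks_zero₂₁, Matrix.det_one, mul_one, Matrix.det_neg,
    Matrix.det_transpose] at e
  refine neg_ne_zero.2 (e.trans_ne ?_)
  exact mul_ne_zero (by simp) hP.inv.det_pos.ne'

lemma extDeriv_smul_Omega_four {f : Coord → ℂ} (hf : DifferentiableAt ℝ f p) (a b c d : Coord) :
    extDeriv (fun q => f q • Omega q) p ![a, b, c, d]
      = fderiv ℝ f p a * Omega p ![b, c, d] - fderiv ℝ f p b * Omega p ![a, c, d]
        + fderiv ℝ f p c * Omega p ![a, b, d] - fderiv ℝ f p d * Omega p ![a, b, c] := by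
  obtain ⟨r0, r1, r2, r3⟩ := removeNth_four a b c d
  rw [extDeriv_smul_Omega hp hf, Fin.sum_univ_four, r0, r1, r2, r3]
  simp [pow_succ]
  ring

omit hp in
lemma Omega_apply_three (a b c : Coord) (x y z : Fin 3 → ℂ)
    (hx : ∀ i, fderiv ℝ (fun q => zc q i) p a = x i)
    (hy : ∀ i, fderiv ℝ (fun q => zc q i) p b = y i)
    (hz : ∀ i, fderiv ℝ (fun q => zc q i) p c = z i) :
    Omega p ![a, b, c] = Complex.exp (zc p 0) * (Matrix.of ![x, y, z]).det := by
  rw [Omega_apply]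
  congr 2
  ext j i
  fin_cases j
  · exact hx i
  · exact hy i
  · exact hz i

lemma Omega_frame (k : Fin 3) :
    Omega p ![torusField 0, torusField 1, torusField 2] = -Complex.I * Complex.exp (zc p 0) ∧
    Omega p ![coneJ p (torusField k), torusField 1, torusField 2]
      = (if k = 0 then 1 else 0) * Complex.exp (zc p 0) ∧
    Omega p ![coneJ p (torusField k), torusField 0, torusField 2]
      = -(if k = 1 then 1 else 0) * Complex.exp (zc p 0) ∧
    Omega p ![coneJ p (torusField k), torusField 0, torusField 1]
      = (if k = 2 then 1 else 0) * Complex.exp (zc p 0) := by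
  have h (j i : Fin 3) := (zc_frame hp i j).1
  have hJ (i : Fin 3) := (zc_frame hp i k).2
  refine ⟨?_, ?_, ?_, ?_⟩
  · rw [Omega_apply_three _ _ _ _ _ _ (h 0) (h 1) (h 2), Matrix.det_fin_three]
    simp
    ring
  · rw [Omega_apply_three _ _ _ _ _ _ hJ (h 1) (h 2), Matrix.det_fin_three]
    simp [eq_comm]
  · rw [Omega_apply_three _ _ _ _ _ _ hJ (h 0) (h 2), Matrix.det_fin_three]
    simp [eq_comm]
  · rw [Omega_apply_three _ _ _ _ _ _ hJ (h 0) (h 1), Matrix.det_fin_three]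
    simp [eq_comm]

/-- The closedness of `f Ω` gives the Cauchy-Riemann equations for `f`. -/
lemma fderiv_coneJ_torusField_of_closed {f : Coord → ℂ} (hf : DifferentiableAt ℝ f p)
    (h : extDeriv (fun q => f q • Omega q) p = 0) (k : Fin 3) :
    fderiv ℝ f p (coneJ p (torusField k)) = Complex.I * fderiv ℝ f p (torusField k) := by
  -- On (J eₖ, e₁, e₂, e₃) only the terms with df(J eₖ) and df(eₖ) survive.
  have hv := extDeriv_smul_Omega_four hp hf
    (coneJ p (torusField k)) (torusField 0) (torusField 1) (torusField 2)
  obtain ⟨o0, o1, o2, o3⟩ := Omega_frame hp k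
  rw [h, alternating_zero_apply, o0, o1, o2, o3] at hv
  have hE := Complex.exp_ne_zero (zc p 0)
  have hI := Complex.I_sq
  apply mul_left_cancel₀ hE
  have hk : fderiv ℝ f p (torusField k) = fderiv ℝ f p (torusField 0) * (if k = 0 then 1 else 0)
      + fderiv ℝ f p (torusField 1) * (if k = 1 then 1 else 0)
      + fderiv ℝ f p (torusField 2) * (if k = 2 then 1 else 0) := by
    fin_cases k <;> simp
  rw [hk]
  generalize fderiv ℝ f p (coneJ p (torusField k)) = x at hv ⊢
  linear_combination -Complex.I * hv + Complex.exp (zc p 0) * x * hI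

/-- Constant modulus gives Re(f̄ df) = 0 in every direction. In the direction J eₖ this reads Im(f̄
df(eₖ)) = 0, so df(eₖ) = 0 as f ≠ 0. -/
lemma fderiv_eq_zero_of_norm_const {f : Coord → ℂ} (hf : DifferentiableAt ℝ f p) {a : ℝ}
    (ha : a ≠ 0) (hn : ∀ᶠ q in nhds p, ‖f q‖ ^ 2 = a)
    (hJ : ∀ k, fderiv ℝ f p (coneJ p (torusField k)) = Complex.I * fderiv ℝ f p (torusField k)) :
    fderiv ℝ f p = 0 := by
  have h0 : f p ≠ 0 := by
    intro h
    have := hn.self_of_nhds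
    rw [h] at this
    simp at this
    exact ha this.symm
  have hre (v : Coord) : (starRingEnd ℂ (f p) * fderiv ℝ f p v).re = 0 := by
    have h1 := hf.hasFDerivAt.norm_sq.fderiv
    have h2 : fderiv ℝ (fun q => ‖f q‖ ^ 2) p = 0 := by
      rw [Filter.EventuallyEq.fderiv_eq (f₁ := fun q => ‖f q‖ ^ 2) (f := fun _ => a) hn]
      simp
    have h3 := congrArg (· v) (h1.symm.trans h2)
    simp [Complex.inner, mul_comm] at h3
    simp
    linarith
  have hk (k : Fin 3) : fderiv ℝ f p (torusField k) = 0 := by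
    have e1 := hre (torusField k)
    have e2 := hre (coneJ p (torusField k))
    rw [hJ, show starRingEnd ℂ (f p) * (Complex.I * fderiv ℝ f p (torusField k))
      = Complex.I * (starRingEnd ℂ (f p) * fderiv ℝ f p (torusField k)) by ring,
      Complex.I_mul_re] at e2
    have e : starRingEnd ℂ (f p) * fderiv ℝ f p (torusField k) = 0 :=
      Complex.ext e1 (neg_eq_zero.1 e2)
    exact (mul_eq_zero.1 e).resolve_left (by simpa using h0)
  ext1 v
  rw [eq_sum_torusField hp v]
  simp [hk, hJ]

end patch

/-! ### Classification of the holomorphic volume forms -/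

/-- Constant multiples of `Ω` of the right modulus are holomorphic volume forms. -/
lemma isHolVolForm_of_eq {W : Coord → Coord [⋀^Fin 3]→L[ℝ] ℂ} {c : ℂ} (hc : ‖c‖ = 1 / 9)
    (hW : ∀ p ∈ patch, W p = c • Omega p) : IsHolVolForm W := by
  have he {p : Coord} (hp : p ∈ patch) : W =ᶠ[nhds p] fun q => c • Omega q := by
    filter_upwards [patch_isOpen.mem_nhds hp] with q hq using hW q hq
  refine ⟨fun p hp => ?_, fun p hp v j => ?_, fun p hp => ?_, fun p hp v => ?_⟩
  · exact (((contDiffAt_Omega hp).const_smul c).congr_of_eventuallyEq (he hp)).contDiffWithinAt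
  · rw [hW p hp, ContinuousAlternatingMap.smul_apply, ContinuousAlternatingMap.smul_apply,
      Omega_type hp, smul_eq_mul, smul_eq_mul]
    ring
  · rw [(he hp).extDeriv_eq]
    ext v
    rw [extDeriv_smul_Omega hp (f := fun _ => c) (differentiableAt_const c),
      alternating_zero_apply]
    simp
  · rw [wedge_conj hp (W p) c (hW p hp), hc]
    norm_num

/-- Every holomorphic volume form is a constant multiple of `Ω`. -/
lemma IsHolVolForm.exists_eq {W : Coord → Coord [⋀^Fin 3]→L[ℝ] ℂ} (hW : IsHolVolForm W) :
    ∃ c : ℂ, ‖c‖ = 1 / 9 ∧ ∀ p ∈ patch, W p = c • Omega p := by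
  -- The factor i e^{-z¹} is the inverse of Ω(e₁, e₂, e₃) = -i e^{z¹}.
  set f : Coord → ℂ := fun q => W q torusField * (Complex.I * Complex.exp (-zc q 0)) with hf
  have hWf : ∀ p ∈ patch, W p = f p • Omega p := by
    intro p hp
    rw [← sub_eq_zero]
    refine eq_zero_of_type hp (fun v j => ?_) ?_
    · simp only [ContinuousAlternatingMap.sub_apply, ContinuousAlternatingMap.smul_apply,
        Omega_type hp, hW.type_three_zero p hp, smul_eq_mul]
      ring
    · have hE : Complex.exp (-zc p 0) * Complex.exp (zc p 0) = 1 := by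
        rw [← Complex.exp_add]; simp
      rw [ContinuousAlternatingMap.sub_apply, ContinuousAlternatingMap.smul_apply,
        Omega_torusField hp, smul_eq_mul, hf]
      linear_combination W p torusField * Complex.I ^ 2 * hE + W p torusField * Complex.I_sq
  have hd : ∀ p ∈ patch, DifferentiableAt ℝ f p := by
    intro p hp
    have h1 : DifferentiableAt ℝ W p :=
      ((hW.smooth p hp).contDiffAt (patch_isOpen.mem_nhds hp)).differentiableAt (by simp)
    have h2 : DifferentiableAt ℝ (fun q => zc q 0) p :=
      (contDiffAt_zc_apply hp 0).differentiableAt (by simp)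
    exact (h1.continuousAlternatingMap_apply_const torusField).mul
      ((h2.neg.cexp).const_mul Complex.I)
  have hn : ∀ p ∈ patch, ‖f p‖ ^ 2 = 1 / 81 := by
    intro p hp
    obtain ⟨v, hv⟩ := exists_coneVol_ne_zero hp
    have h := hW.normalized p hp v
    rw [wedge_conj hp (W p) (f p) (hWf p hp), Complex.ofReal_inj] at h
    have := mul_right_cancel₀ hv (h.trans (one_mul _).symm)
    linarith
  have h0 : ∀ p ∈ patch, fderiv ℝ f p = 0 := by
    intro p hp
    have hclosed : extDeriv (fun q => f q • Omega q) p = 0 := by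
      rw [← hW.closed p hp]
      refine Filter.EventuallyEq.extDeriv_eq ?_
      filter_upwards [patch_isOpen.mem_nhds hp] with q hq using (hWf q hq).symm
    refine fderiv_eq_zero_of_norm_const hp (hd p hp) (a := 1 / 81) (by norm_num) ?_
      (fderiv_coneJ_torusField_of_closed hp (hd p hp) hclosed)
    filter_upwards [patch_isOpen.mem_nhds hp] with q hq using hn q hq
  -- Any base point serves; only nonemptiness of the patch is needed.
  obtain ⟨p₀, hp₀, -⟩ := logRadii_angle_surjective 0 0
  refine ⟨f p₀, ?_, fun p hp => ?_⟩
  · have h1 : ‖f p₀‖ ^ 2 = (1 / 9) ^ 2 := by rw [hn p₀ hp₀]; norm_num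
    exact (pow_left_inj₀ (norm_nonneg _) (by norm_num) two_ne_zero).1 h1
  · rw [hWf p hp, patch_isOpen.is_const_of_fderiv_eq_zero patch_convex.isPreconnected
      (fun q hq => (hd q hq).differentiableWithinAt) (fun q hq => h0 q hq) hp hp₀]

end Conifold

end

theorem mainTheorem2 :
    -- the Kähler cone: `J² = -1`, `J (r ∂_r) = B`, `ω(v, w) = g(J v, w)`, `η(B) = 1`
    (∀ p ∈ Conifold.patch,
      (∀ v, Conifold.coneJ p (Conifold.coneJ p v) = -v) ∧
      Conifold.coneJ p (Conifold.eulerField p) = Conifold.reebField ∧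
      (∀ v w, Conifold.kahlerForm p ![v, w]
        = Conifold.coneMetric p (Conifold.coneJ p v) w) ∧
      Conifold.eta p Conifold.reebField = 1) ∧
    -- toric data: torus generators, Reeb vector, momentum map and momentum cone
    (∀ p i j, fderiv ℝ (fun q => Conifold.angle q i) p (Conifold.torusField j)
      = if i = j then 1 else 0) ∧
    Conifold.reebField = ∑ i, Conifold.reebVec i • Conifold.torusField i ∧
    Conifold.canVec = ![4, 2, 2] ∧
    (∀ p, Conifold.momentum p =
      ![1 / 6 * p 0 ^ 2 * (Real.cos (p 1) + 1),
        1 / 6 * p 0 ^ 2 * (Real.cos (p 2) - Real.cos (p 1)),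
        -(1 / 6 * p 0 ^ 2 * (Real.cos (p 1) + Real.cos (p 2)))]) ∧
    Conifold.momentum '' Conifold.patch = Conifold.openCone ∧
    Conifold.momentum '' Conifold.closedPatch
      = {y | y ≠ 0 ∧ ∀ A, 0 ≤ Conifold.normal A ⬝ᵥ y} ∧
    -- `G` is a symplectic potential of the cone, and solves the Monge-Ampère equation
    ContDiffOn ℝ ∞ Conifold.G Conifold.openCone ∧
    StrictConvexOn ℝ Conifold.openCone Conifold.G ∧
    (∀ y ∈ Conifold.openCone,
      (Conifold.hessG y).PosDef ∧
      Conifold.reebVec = (2 : ℝ) • Matrix.mulVec (Conifold.hessG y) y ∧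
      (Conifold.hessG y).det
        = 81 * Real.exp 3 / 2 ^ 11 * Real.exp (-2 * Conifold.gradG y 0)) ∧
    (∀ p ∈ Conifold.patch, ∀ v w,
      Conifold.kahlerForm p ![v, w]
        = ∑ i, (fderiv ℝ (fun q => Conifold.momentum q i) p v
              * fderiv ℝ (fun q => Conifold.angle q i) p w
            - fderiv ℝ (fun q => Conifold.momentum q i) p w
              * fderiv ℝ (fun q => Conifold.angle q i) p v) ∧
      Conifold.coneMetric p v w
        = (∑ i, ∑ j, Conifold.hessG (Conifold.momentum p) i j
              * fderiv ℝ (fun q => Conifold.momentum q i) p v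
              * fderiv ℝ (fun q => Conifold.momentum q j) p w)
          + ∑ i, ∑ j, (Conifold.hessG (Conifold.momentum p))⁻¹ i j
              * fderiv ℝ (fun q => Conifold.angle q i) p v
              * fderiv ℝ (fun q => Conifold.angle q j) p w) ∧
    -- the Legendre transform of `G`: Kähler potential `F` and dual coordinates `x`
    Set.BijOn Conifold.gradG Conifold.openCone Set.univ ∧
    (∃ F : (Fin 3 → ℝ) → ℝ, ContDiff ℝ ∞ F ∧
      (∀ y ∈ Conifold.openCone,
        F (Conifold.gradG y) = (∑ i, y i * Conifold.gradG y i) - Conifold.G y ∧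
        ∀ i, Conifold.pd i F (Conifold.gradG y) = y i) ∧
      ∀ p ∈ Conifold.patch, F (Conifold.gradG (Conifold.momentum p)) = p 0 ^ 2 / 4) ∧
    (∀ p ∈ Conifold.patch, ∀ i,
      Conifold.zc p i
        = ((Conifold.gradG (Conifold.momentum p) i - Conifold.shift i : ℝ) : ℂ)
          + Complex.I * (Conifold.angle p i : ℂ)) ∧
    -- `z` is a system of holomorphic coordinates, with values filling `ℂ³`
    ContDiffOn ℝ ∞ Conifold.zc Conifold.patch ∧
    Set.BijOn Conifold.zc Conifold.patch Set.univ ∧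
    (∀ p ∈ Conifold.patch, Function.Bijective (fderiv ℝ Conifold.zc p)) ∧
    (∀ p ∈ Conifold.patch, ∀ v,
      fderiv ℝ Conifold.zc p (Conifold.coneJ p v)
        = Complex.I • fderiv ℝ Conifold.zc p v) ∧
    -- the holomorphic volume forms are the multiples of `e^{z¹} dz¹ ∧ dz² ∧ dz³`
    (∀ W : Conifold.Coord → Conifold.Coord [⋀^Fin 3]→L[ℝ] ℂ,
      Conifold.IsHolVolForm W ↔
        ∃ c : ℂ, ‖c‖ = 1 / 9 ∧ ∀ p ∈ Conifold.patch, W p = c • Conifold.Omega p) := by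
  open Conifold in
  refine ⟨fun p hp => ⟨coneJ_coneJ hp, coneJ_eulerField hp, kahlerForm_eq_coneMetric hp,
    eta_reebField p⟩, fun p i j => (fderiv_angle p _ i).trans (angle_torusField i j), reebField_eq,
    canVec_eq, momentum_eq, momentum_image_patch, momentum_image_closedPatch,
    fun y hy => (contDiffAt_G hy).contDiffWithinAt, strictConvexOn_G,
    fun y hy => ⟨hessG_posDef hy, reebVec_eq_hessG_mulVec hy, monge_ampere hy⟩,
    fun p hp v w => ?_, gradG_bijOn,
    ⟨kahlerPotential, contDiff_kahlerPotential, fun y hy => ?_,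
      fun p hp => kahlerPotential_gradG hp⟩,
    fun p hp i => zc_eq_gradG hp i, fun p hp => (contDiffAt_zc hp).contDiffWithinAt, zc_bijOn,
    fun p hp => fderiv_zc_bijective hp, fun p hp v => fderiv_zc_coneJ hp v,
    fun W => ⟨fun hW => hW.exists_eq, fun ⟨c, hc, hW⟩ => isHolVolForm_of_eq hc hW⟩⟩
  · simp only [Conifold.fderiv_momentum, Conifold.fderiv_angle]
    exact ⟨Conifold.kahlerForm_darboux p v w, Conifold.coneMetric_eq hp v w⟩
  · have h := Conifold.legendre_G hy
    -- Every y of the open cone comes from the patch, where ½⟨B, y⟩ = r²/4.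
    rw [← Conifold.momentum_image_patch] at hy
    obtain ⟨p, hp, rfl⟩ := hy
    refine ⟨?_, Conifold.pd_kahlerPotential hp⟩
    rw [h, Conifold.kahlerPotential_gradG hp, Conifold.reebVec_dotProduct,
      (Conifold.momentum_linear_forms p).2.2.2.2]
    ring
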